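/- Let $G=(V,E)$ be a finite multigraph (parallel edges and selfloops are allowed) and let $T\subseteq V$. A $T$-path is a path in $G$ (without repeated vertices) whose ends are two distinct vertices of $T$ and none of whose internal vertices belongs to $T$. A $T$-subpartition is a family $\mathcal{X}=(X_s)_{s\in T}$ of mutually disjoint subsets $X_s\subseteq V$ with $X_s\cap T=\{s\}$ for each $s\in T$. For $X\subseteq V$ let $d(X)$ be the number of edges of $G$ between $X$ and $V\setminus X$. Let $G\setminus\mathcal{X}$ be the graph obtained from $G$ by deleting all vertices of $\bigcup_{s\in T}X_s$ and their incident edges, and let $\mathrm{odd}(G\setminus\mathcal{X})$ be the number of connected components of $G\setminus\mathcal{X}$ whose vertex set $K$ has odd $d(K)$ (with $d$ taken in $G$). Put $$\kappa(\mathcal{X})=\frac12\Bigl[\sum_{s\in T}d(X_s)-\mathrm{odd}(G\setminus\mathcal{X})\Bigr].$$ Then the maximum number of pairwise edge-disjoint $T$-paths in $G$ equals the minimum of $\kappa(\mathcal{X})$ over all $T$-subpartitions $\mathcal{X}$. -/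

import Mathlib

namespace Graph

/-- A walk `(v₀, e₁, v₁, …, e_ℓ, v_ℓ)` in a multigraph: each `eᵢ` is an edge with ends
`vᵢ₋₁` and `vᵢ`. -/
inductive Walk {α β : Type*} (G : Graph α β) : α → α → Type _
  | nil (x : α) (hx : x ∈ G.vertexSet) : Walk G x x
  | cons {x y z : α} (e : β) (h : G.IsLink e x y) (w : Walk G y z) : Walk G x z

/-- The sequence of vertices of a walk. -/
def Walk.support {α β : Type*} {G : Graph α β} : {x y : α} → G.Walk x y → List α
  | x, _, .nil _ _ => [x]
  | x, _, .cons _ _ w => x :: w.support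

/-- The sequence of edges of a walk. -/
def Walk.edges {α β : Type*} {G : Graph α β} : {x y : α} → G.Walk x y → List β
  | _, _, .nil _ _ => []
  | _, _, .cons e _ w => e :: w.edges

/-- A path is a walk without repeated vertices. -/
def Walk.IsPath {α β : Type*} {G : Graph α β} {x y : α} (w : G.Walk x y) : Prop :=
  w.support.Nodup

/-- A `T`-path: a path whose ends are distinct vertices in `T` and none of whose internal
vertices belongs to `T`. -/
structure TPath {α β : Type*} (G : Graph α β) (T : Finset α) where
  source : α
  target : α
  walk : G.Walk source target
  isPath : walk.IsPath
  source_mem : source ∈ T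
  target_mem : target ∈ T
  source_ne_target : source ≠ target
  internal_notMem : ∀ x ∈ walk.support, x ≠ source → x ≠ target → x ∉ T

/-- `G` has `k` pairwise edge-disjoint `T`-paths. -/
def HasEdgeDisjointTPaths {α β : Type*} (G : Graph α β) (T : Finset α) (k : ℕ) : Prop :=
  ∃ P : Fin k → G.TPath T, Pairwise fun i j => (P i).walk.edges.Disjoint (P j).walk.edges

/-- `δ(X)`: the set of edges between `X` and `V(G) \ X`. -/
def cutEdges {α β : Type*} (G : Graph α β) (X : Set α) : Set β :=
  {e | ∃ x ∈ X, ∃ y ∈ G.vertexSet \ X, G.IsLink e x y}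

/-- `d(X) = |δ(X)|`. -/
noncomputable def cutSize {α β : Type*} (G : Graph α β) (X : Set α) : ℕ :=
  (G.cutEdges X).ncard

/-- `K` is the vertex set of a connected component of `H`. -/
def IsComponentSet {α β : Type*} (H : Graph α β) (K : Set α) : Prop :=
  ∃ x ∈ H.vertexSet, K = {y | Nonempty (H.Walk x y)}

/-- A `T`-subpartition: mutually disjoint sets `X s ⊆ V(G)`, indexed by `s ∈ T`, such that
`X s ∩ T = {s}` for each `s ∈ T`. -/
structure IsTSubpartition {α β : Type*} (G : Graph α β) (T : Finset α) (X : T → Set α) :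
    Prop where
  subset_vertexSet : ∀ s, X s ⊆ G.vertexSet
  pairwise_disjoint : Pairwise fun s t => Disjoint (X s) (X t)
  inter_eq : ∀ s, X s ∩ (T : Set α) = {(s : α)}

/-- `odd(G \ 𝒳)`: the number of connected components `K` of the graph obtained from `G` by
deleting all vertices in the sets `X s` such that `d(K)`, taken in `G`, is odd. -/
noncomputable def oddComponents {α β : Type*} (G : Graph α β) (T : Finset α)
    (X : T → Set α) : ℕ :=
  {K : Set α | (G.deleteVerts (⋃ s, X s)).IsComponentSet K ∧ Odd (G.cutSize K)}.ncard

/-- `κ(𝒳) = ½ [∑ₛ d(X s) - odd(G \ 𝒳)]`. -/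
noncomputable def kappa {α β : Type*} (G : Graph α β) (T : Finset α) (X : T → Set α) : ℚ :=
  (1 / 2 : ℚ) * ((∑ s : T, (G.cutSize (X s) : ℚ)) - (G.oddComponents T X : ℚ))

end Graph

/-! The inequality "max ≤ min" is a count. Each `T`-path leaves the set of its source and enters the
set of its target. It crosses the boundary of every component of `G \ 𝒳` an even number of times, so
each odd component leaves a boundary edge unused, and that edge is counted in some `d(X s)`
(`two_mul_add_le`).

For the converse the graph becomes a network `g`: every edge end is an inner vertex (`inl`) or a
terminal class (`inr`). Paths become lists of distinct edges in which consecutive edges share an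
inner vertex. The edges at a vertex `x` form a clique for this relation, so lists can be cut and
glued at `x` freely. Edges without inner end are left out of `weight` and treated separately: each
contributes one path and two boundary ends.

If every class has at most one edge to an inner vertex, terminal edges in the same component of
inner vertices are paired maximally with minimal total length (`exists_disjoint_pairing`). The paths
are then edge-disjoint, and a component keeps an unpaired terminal edge only if its boundary is odd.
The all-unassigned `φ` is optimal (`hasMinMax_of_injective`).

Otherwise some class `s` has two such edges; let `e₀` be one, with inner end `x`. Two smaller
networks are solved: in one the `s`-end of `e₀` is moved to a fresh class, in the other `x` is
identified with `s`. Let the first give `k` paths. Its dual solution, read in `g`, certifies `k`.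
Its paths are valid in `g`, except perhaps one that returns to `s`; that one falls apart into two
chains from `s` to `x`. The second network, together with the edges from `x` to other classes, gives
`k'` chains that join two classes or run from a class other than `s` to `x`, and its dual certifies
`k'`. If `k' < k`, the `k - 1` remaining paths match the second dual. If `k' ≥ k`, an exchange
argument (`exists_all_reg`) combines the two families into `k` genuine paths, matching the first
dual.

The exchange is in the style of augmenting paths. While the second family has a chain ending at `x`,
it uses fewer terminal edges than the first, so some terminal edge `v` is used only by the first.
The first family's chain is followed from `v` to its first meeting with the second family, and the
chain met there is rerouted. This either uses more terminal edges or follows the first family more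
closely (fewer `breaks`), so the process stops. -/

namespace Routing

/-! ### Chains in a symmetric relation and the class-carrying elements on them -/

open Classical in
/-- The number of elements of a list that carry a class. -/
noncomputable def slotCount {E C : Type*} (cl : E → Option C) (l : List E) : ℕ :=
  l.countP fun e => decide (cl e ≠ none)

/-- A chain joining two elements of distinct classes, without classes in between. -/
def Reg {E C : Type*} (R : E → E → Prop) (cl : E → Option C) (l : List E) : Prop :=
  l.IsChain R ∧ ∃ a b c c', l.head? = some a ∧ l.getLast? = some b ∧ cl a = some c ∧
    cl b = some c' ∧ c ≠ c' ∧ ∀ e ∈ l, e ≠ a → e ≠ b → cl e = none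

/-- A chain from an element with class in `S` to an element of `X`, without further classes. -/
def Semi {E C : Type*} (R : E → E → Prop) (cl : E → Option C) (X : E → Prop) (S : C → Prop)
    (l : List E) : Prop :=
  l.IsChain R ∧ ∃ a b c, l.head? = some a ∧ l.getLast? = some b ∧ cl a = some c ∧
    S c ∧ X b ∧ ∀ e ∈ l, e ≠ a → cl e = none

section

variable {E C : Type*} {R : E → E → Prop} {cl : E → Option C} {X : E → Prop}

theorem Reg.reverse (hR : ∀ e f, R e f → R f e) {l : List E} (h : Reg R cl l) :
    Reg R cl l.reverse := by
  obtain ⟨h1, a, b, c, c', ha, hb, hc, hc', hne, hi⟩ := h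
  refine ⟨List.isChain_reverse.2 (h1.imp fun _ _ h => hR _ _ h), b, a, c', c, by simpa using hb,
    by simpa using ha, hc', hc, hne.symm, fun e he h1 h2 => hi e (by simpa using he) h2 h1⟩

theorem slotCount_of_toFinset {l : List E} (hl : l.Nodup) [DecidableEq E] (s : Finset E)
    (h : ∀ e, e ∈ s ↔ e ∈ l ∧ cl e ≠ none) : slotCount cl l = s.card := by
  classical
  have : s = (l.filter fun e => decide (cl e ≠ none)).toFinset := by
    ext e; simp [h e]
  rw [this, List.toFinset_card_of_nodup (hl.filter _), slotCount, List.countP_eq_length_filter]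

theorem Reg.slotCount {l : List E} (h : Reg R cl l) (hl : l.Nodup) : slotCount cl l = 2 := by
  classical
  obtain ⟨h1, a, b, c, c', ha, hb, hc, hc', hne, hi⟩ := h
  have hab : a ≠ b := by rintro rfl; rw [hc] at hc'; exact hne (Option.some.inj hc')
  rw [slotCount_of_toFinset hl {a, b}, Finset.card_pair hab]
  intro e
  have := List.mem_of_mem_head? (Option.mem_def.2 ha)
  have := List.mem_of_getLast? hb
  have := hi e
  grind

theorem Semi.slotCount {S : C → Prop} {l : List E} (h : Semi R cl X S l) (hl : l.Nodup) :
    slotCount cl l = 1 := by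
  classical
  obtain ⟨h1, a, b, c, ha, hb, hc, hS, hX, hi⟩ := h
  rw [slotCount_of_toFinset hl {a}, Finset.card_singleton]
  intro e
  have := List.mem_of_mem_head? (Option.mem_def.2 ha)
  have := hi e
  grind

theorem exists_first {p : E → Prop} {l : List E} (h : ∃ x ∈ l, p x) :
    ∃ C h D, l = C ++ h :: D ∧ p h ∧ ∀ x ∈ C, ¬ p x := by
  induction l with
  | nil => simp at h
  | cons a l ih =>
    by_cases ha : p a
    · exact ⟨[], a, l, rfl, ha, by simp⟩
    · obtain ⟨C, b, D, rfl, hb, hC⟩ := ih (by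
        obtain ⟨x, hx, hp⟩ := h
        rcases List.mem_cons.1 hx with rfl | hx
        · exact absurd hp ha
        · exact ⟨x, hx, hp⟩)
      exact ⟨a :: C, b, D, rfl, hb, by simpa [ha] using hC⟩

/-! ### Deviation of a chain from a reference family -/

open Classical in
/-- The number of consecutive pairs of a list that are not related by `K`. -/
noncomputable def breaks (K : E → E → Prop) : List E → ℕ
  | [] => 0
  | [_] => 0
  | a :: b :: l => (if K a b then 0 else 1) + breaks K (b :: l)

theorem breaks_append (K : E → E → Prop) (A : List E) (h : E) (B : List E) :
    breaks K (A ++ h :: B) = breaks K (A ++ [h]) + breaks K (h :: B) := by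
  induction A with
  | nil => simp [breaks]
  | cons a A ih =>
    cases A with
    | nil => simp [breaks]
    | cons b A => simp only [List.cons_append, breaks] at ih ⊢; omega

theorem breaks_reverse {K : E → E → Prop} (hK : ∀ e f, K e f → K f e) (l : List E) :
    breaks K l.reverse = breaks K l := by
  induction l with
  | nil => rfl
  | cons a l ih =>
    cases l with
    | nil => rfl
    | cons b l =>
      have : K b a ↔ K a b := ⟨hK _ _, hK _ _⟩
      simp only [List.reverse_cons, List.append_assoc] at ih ⊢
      rw [List.singleton_append, breaks_append, ih]
      by_cases h : K a b
      · simp [breaks, h, this.2 h]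
      · simp [breaks, h, mt this.1 h, add_comm]

theorem breaks_eq_zero {K : E → E → Prop} {l : List E} : breaks K l = 0 ↔ l.IsChain K := by
  induction l with
  | nil => simp [breaks]
  | cons a l ih =>
    cases l with
    | nil => simp [breaks]
    | cons b l => simp [breaks, ih]

/-- Two elements are consecutive in a list of the family `P`. -/
def Consec (P : List (List E)) (e f : E) : Prop :=
  ∃ p ∈ P, [e, f] <:+: p ∨ [f, e] <:+: p

theorem Consec.symm {P : List (List E)} {e f : E} (h : Consec P e f) : Consec P f e := by
  obtain ⟨p, hp, h⟩ := h
  exact ⟨p, hp, h.symm⟩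

theorem eq_of_mem_of_mem {P : List (List E)} (hP : P.flatten.Nodup) {p q : List E} {e : E}
    (hp : p ∈ P) (hq : q ∈ P) (he : e ∈ p) (he' : e ∈ q) : p = q := by
  obtain ⟨P1, P2, rfl⟩ := List.append_of_mem hp
  have hperm : (P1 ++ p :: P2).Perm (p :: (P1 ++ P2)) := List.perm_middle
  rw [hperm.flatten.nodup_iff, List.flatten_cons, List.nodup_append'] at hP
  rcases List.mem_cons.1 (hperm.mem_iff.1 hq) with h | h
  · exact h.symm
  · exact absurd (List.mem_flatten.2 ⟨q, h, he'⟩) (hP.2.2 he)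

theorem Consec.mem {P : List (List E)} (hP : P.flatten.Nodup) {p : List E} {e f : E}
    (hp : p ∈ P) (he : e ∈ p) (h : Consec P e f) : f ∈ p := by
  obtain ⟨q, hq, h⟩ := h
  have hsub : e ∈ q ∧ f ∈ q := by
    rcases h with h | h <;> exact ⟨h.subset (by simp), h.subset (by simp)⟩
  rw [eq_of_mem_of_mem hP hp hq he hsub.1]
  exact hsub.2

theorem isChain_consec {P : List (List E)} {p : List E} (hp : p ∈ P) : p.IsChain (Consec P) :=
  (List.isChain_isInfix p).imp fun _ _ h => ⟨p, hp, Or.inl h⟩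

theorem mem_of_isChain_consec {P : List (List E)} (hP : P.flatten.Nodup) {p : List E}
    (hp : p ∈ P) {h : E} {B : List E} (hh : h ∈ p) (hB : (h :: B).IsChain (Consec P)) :
    ∀ e ∈ h :: B, e ∈ p := by
  induction B generalizing h with
  | nil => simpa using hh
  | cons b B ih =>
    rw [List.isChain_cons_cons] at hB
    have := ih (hB.1.mem hP hp hh) hB.2
    intro e he
    rcases List.mem_cons.1 he with rfl | he
    · exact hh
    · exact this e he

/-- The last clause is additive in an arbitrary `f`, so that slot counts and breaks are both tracked
by the same replacement without subtraction. -/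
theorem exists_replace {Q : List (List E)} (hQ : Q.flatten.Nodup) {q q' : List E} (hq : q ∈ Q)
    (hn : q'.Nodup) (hm : ∀ e ∈ q', e ∈ q ∨ e ∉ Q.flatten) :
    ∃ Q' : List (List E), Q'.length = Q.length ∧ Q'.flatten.Nodup ∧ (∀ x ∈ Q', x = q' ∨ x ∈ Q) ∧
      ∀ f : List E → ℕ, (Q'.map f).sum + f q = (Q.map f).sum + f q' := by
  obtain ⟨Q1, Q2, rfl⟩ := List.append_of_mem hq
  have hp : (Q1 ++ q :: Q2).Perm (q :: (Q1 ++ Q2)) := List.perm_middle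
  have hQ1 : (q :: (Q1 ++ Q2)).flatten.Nodup := hp.flatten.nodup_iff.1 hQ
  refine ⟨q' :: (Q1 ++ Q2), by simp; omega, ?_, ?_, ?_⟩
  · rw [List.flatten_cons, List.nodup_append'] at hQ1 ⊢
    refine ⟨hn, hQ1.2.1, fun e he he' => ?_⟩
    rcases hm e he with h | h
    · exact hQ1.2.2 h he'
    · apply h
      rw [hp.flatten.mem_iff, List.flatten_cons]
      exact List.mem_append_right _ he'
  · intro x hx
    rcases List.mem_cons.1 hx with h | h
    · exact Or.inl h
    · right; simp at h ⊢; tauto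
  · intro f
    rw [(hp.map f).sum_eq]
    simp; omega

/-! ### Rerouting a chain along a lead -/

/-- A chain starting with `v`, of class `Y`, and first leaving its initial part `A` at `h`;
`K` relates the consecutive elements of a family containing the chain. -/
structure Lead (R : E → E → Prop) (cl : E → Option C) (K : E → E → Prop) (v : E) (Y : C)
    (A : List E) (h : E) (D : List E) : Prop where
  nodup : (v :: A ++ h :: D).Nodup
  chain : (v :: A ++ h :: D).IsChain R
  chainK : (v :: A ++ h :: D).IsChain K
  symmK : ∀ e f, K e f → K f e
  class_eq : cl v = some Y
  last : ∀ e ∈ v :: A ++ h :: D, e ≠ v → cl e ≠ none →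
    (v :: A ++ h :: D).getLast? = some e ∧ cl e ≠ some Y
  closed : ∀ B, (h :: B).IsChain K → ∀ e ∈ h :: B, e ∈ v :: A ++ h :: D

theorem Lead.none_of_mem {K : E → E → Prop} {v h : E} {Y : C} {A D : List E}
    (H : Lead R cl K v Y A h D) : ∀ e ∈ A, cl e = none := by
  intro e he
  by_contra hne
  have hn := H.nodup
  have hev : e ≠ v := by rintro rfl; simp at hn; tauto
  have := (H.last e (by simp [he]) hev hne).1
  rw [List.getLast?_append] at this
  have h2 : e ∈ h :: D := by
    apply List.mem_of_getLast?
    simpa using this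
  rw [List.nodup_append'] at hn
  exact hn.2.2 (List.mem_cons_of_mem _ he) h2

theorem chain_splice {A B A' D : List E} {h : E}
    (h1 : (A' ++ h :: D).IsChain R) (h2 : (A ++ h :: B).IsChain R) :
    (A' ++ h :: B).IsChain R := by
  have h3 : (A' ++ [h]).IsChain R := h1.prefix ⟨D, by simp⟩
  have h4 : (h :: B).IsChain R := h2.right_of_append
  have := h3.append_overlap (l₂ := [h]) (l₃ := B) (by simpa using h4) (by simp)
  simpa using this

/-- Replacing the initial part of `q` by the lead either decreases the number of breaks, or the
initial part of `q` runs along the lead. -/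
theorem Lead.reroute {K : E → E → Prop} {v h : E} {Y : C}
    {A D : List E} (H : Lead R cl K v Y A h D) {A' B : List E} (hq : (A' ++ h :: B).Nodup)
    (hqR : (A' ++ h :: B).IsChain R) {y z : E} (hy : (A' ++ h :: B).head? = some y)
    (hz : (A' ++ h :: B).getLast? = some z) (hcy : cl y ≠ none)
    (hi : ∀ e ∈ A' ++ h :: B, e ≠ y → e ≠ z → cl e = none)
    (hd : ∀ e ∈ v :: A, e ∉ A' ++ h :: B) :
    ((v :: A ++ h :: B).Nodup ∧ (v :: A ++ h :: B).IsChain R ∧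
      (v :: A ++ h :: B).getLast? = some z ∧
      (∀ e ∈ v :: A ++ h :: B, e ≠ v → e ≠ z → cl e = none) ∧
      y ∉ v :: A ++ h :: B ∧ breaks K (v :: A ++ h :: B) < breaks K (A' ++ h :: B)) ∨
    ((v :: A ++ h :: D).getLast? = some y ∧ cl y ≠ some Y) := by
  -- The lead has no breaks up to `h`, so the exchange gains exactly the breaks of `A' ++ [h]`. If
  -- there are none, `A'` read backwards from `h` stays on the lead's own chain, so `y` lies on it;
  -- carrying a class and differing from `v`, it must be the other end.
  by_cases hb : breaks K (A' ++ [h]) = 0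
  · right
    have hvy : y ≠ v := by
      rintro rfl
      exact hd y (by simp) (List.mem_of_mem_head? (Option.mem_def.2 hy))
    refine H.last y ?_ hvy hcy
    rw [← breaks_reverse H.symmK, breaks_eq_zero] at hb
    apply H.closed A'.reverse (by simpa using hb) y
    cases A' with
    | nil => simp at hy; simp [hy]
    | cons a A' => simp at hy; simp [hy]
  · left
    have hA' : A' ≠ [] := by rintro rfl; simp [breaks] at hb
    obtain ⟨a, A', rfl⟩ := List.exists_cons_of_ne_nil hA'
    obtain rfl : a = y := by simpa using hy
    have hA := H.none_of_mem
    refine ⟨?_, chain_splice H.chain hqR, ?_, ?_, ?_, ?_⟩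
    · have h1 := H.nodup
      rw [List.nodup_append'] at h1 hq ⊢
      refine ⟨h1.1, hq.2.1, fun e he he' => hd e he (List.mem_append_right _ he')⟩
    · rw [List.getLast?_append] at hz ⊢
      simpa using hz
    · intro e he hev hez
      rw [List.mem_append, List.mem_cons] at he
      rcases he with (he | he) | he
      · exact absurd he hev
      · exact hA e he
      · refine hi e (List.mem_append_right _ he) ?_ hez
        rintro rfl
        rw [List.nodup_append'] at hq
        exact hq.2.2 (by simp) he
    · intro hmem
      rcases List.mem_append.1 hmem with hmem | hmem
      · exact hd a hmem (by simp)
      · rw [List.nodup_append'] at hq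
        exact hq.2.2 (by simp) hmem
    · rw [breaks_append K (v :: A), breaks_append K (a :: A')]
      have : breaks K (v :: A ++ [h]) = 0 :=
        breaks_eq_zero.2 (H.chainK.prefix ⟨D, by simp⟩)
      omega

/-- Keeping either end of `q` is allowed as long as its class is not `Y`, so `reroute` is tried in
both directions. If neither helps, then either an end of class `Y` would be the far end of the lead,
whose class is not `Y`, or both ends of `q` would equal that far end. -/
theorem Lead.reroute_reg {K : E → E → Prop} (hR : ∀ e f, R e f → R f e) {v h : E} {Y : C}
    {A D : List E} (H : Lead R cl K v Y A h D) {q : List E} (hq : q.Nodup) (hqR : Reg R cl q)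
    (hh : h ∈ q) (hd : ∀ e ∈ v :: A, e ∉ q) :
    ∃ q' : List E, q'.Nodup ∧ Reg R cl q' ∧ (∀ e ∈ q', e ∈ q ∨ e ∈ v :: A) ∧
      breaks K q' < breaks K q := by
  have key : ∀ q : List E, q.Nodup → q.IsChain R → ∀ y z c c', q.head? = some y →
      q.getLast? = some z → cl y = some c → cl z = some c' →
      (∀ e ∈ q, e ≠ y → e ≠ z → cl e = none) → h ∈ q → (∀ e ∈ v :: A, e ∉ q) → c' ≠ Y →
      (∃ q' : List E, q'.Nodup ∧ Reg R cl q' ∧ (∀ e ∈ q', e ∈ q ∨ e ∈ v :: A) ∧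
      breaks K q' < breaks K q) ∨ ((v :: A ++ h :: D).getLast? = some y ∧ cl y ≠ some Y) := by
    intro q hq hqR y z c c' hy hz hcy hcz hi hh hd hne
    obtain ⟨A', B, rfl⟩ := List.append_of_mem hh
    rcases H.reroute hq hqR hy hz (by simp [hcy]) hi hd with h | h
    · refine Or.inl ⟨_, h.1, ⟨h.2.1, v, z, Y, c', by simp, h.2.2.1, H.class_eq, hcz, hne.symm,
        h.2.2.2.1⟩, ?_, h.2.2.2.2.2⟩
      intro e he
      simp only [List.mem_append] at he ⊢
      tauto
    · exact Or.inr h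
  obtain ⟨hc, y, z, c, c', hy, hz, hcy, hcz, hcc, hi⟩ := hqR
  have k1 := key q hq hc y z c c' hy hz hcy hcz hi hh hd
  have k2 := key q.reverse (List.nodup_reverse.2 hq)
    (List.isChain_reverse.2 (hc.imp fun _ _ h => hR _ _ h)) z y c' c (by simpa using hz)
    (by simpa using hy) hcz hcy (fun e he h1 h2 => hi e (by simpa using he) h2 h1) (by simpa using hh)
    (by simpa using hd)
  rw [breaks_reverse H.symmK] at k2
  simp only [List.mem_reverse] at k2
  by_contra hcon
  have k1' := fun h => (k1 h).resolve_left hcon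
  have k2' := fun h => (k2 h).resolve_left hcon
  have hyz : y ≠ z := by rintro rfl; rw [hcy] at hcz; exact hcc (Option.some.inj hcz)
  by_cases h1 : c' = Y
  · have := k2' (by rw [← h1]; exact hcc)
    exact this.2 (by rw [hcz, h1])
  · have h2 := k1' h1
    have h3 := k2' (fun h => h2.2 (by rw [hcy, h]))
    rw [h2.1] at h3
    exact hyz (Option.some.inj h3.1)

/-- An element that carries a class is an end of its chain, so after a possible reversal the chain
starts there. A semi-regular chain carries only one class, so it never needs reversing. -/
theorem exists_lead_or {P : List (List E)} (hR : ∀ e f, R e f → R f e) {s : C}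
    (hP : ∀ p ∈ P, Reg R cl p ∨ Semi R cl X (· = s) p) (hPn : P.flatten.Nodup) {p : List E}
    (hp : p ∈ P) {v : E} (hv : v ∈ p) {Y : C} (hY : cl v = some Y) :
    ∃ p' : List E, (∀ e ∈ p', e ∈ p) ∧ p'.head? = some v ∧ p'.Nodup ∧
      (Reg R cl p' ∨ Semi R cl X (· = s) p') ∧
      ∀ A h D, p' = v :: A ++ h :: D → Lead R cl (Consec P) v Y A h D := by
  have hpn : p.Nodup := (List.nodup_flatten.1 hPn).1 p hp
  have hK := isChain_consec hp
  have main : ∀ p' : List E, (∀ e, e ∈ p' ↔ e ∈ p) → p'.Nodup → p'.IsChain R →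
      p'.IsChain (Consec P) →
      (∀ e ∈ p', e ≠ v → cl e ≠ none → p'.getLast? = some e ∧ cl e ≠ some Y) →
      ∀ A h D, p' = v :: A ++ h :: D → Lead R cl (Consec P) v Y A h D := by
    rintro p' hm h1 h2 h3 h4 A h D rfl
    refine ⟨h1, h2, h3, fun _ _ h => h.symm, hY, h4, fun B hB e he => ?_⟩
    exact (hm e).2 (mem_of_isChain_consec hPn hp ((hm h).1 (by simp)) hB e he)
  have last : ∀ p' : List E, (∀ e, e ∈ p' ↔ e ∈ p) → ∀ b c', p'.getLast? = some b →
      cl b = some c' → Y ≠ c' → (∀ e ∈ p', e ≠ v → e ≠ b → cl e = none) →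
      ∀ e ∈ p', e ≠ v → cl e ≠ none → p'.getLast? = some e ∧ cl e ≠ some Y := by
    intro p' hm b c' hb hc hne hi e he hev hce
    by_cases heb : e = b
    · subst heb
      exact ⟨hb, by rw [hc]; intro h; exact hne (Option.some.inj h).symm⟩
    · exact absurd (hi e he hev heb) hce
  rcases hP p hp with hreg | hsemi
  · have hreg' := hreg
    obtain ⟨h1, a, b, c, c', ha, hb, hc, hc', hne, hi⟩ := hreg
    by_cases hva : v = a
    · subst hva
      obtain rfl : c = Y := by rw [hc] at hY; exact Option.some.inj hY
      exact ⟨p, fun e he => he, ha, hpn, Or.inl hreg',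
        main p (fun _ => Iff.rfl) hpn h1 hK (last p (fun _ => Iff.rfl) b c' hb hc' hne hi)⟩
    · have hvb : v = b := by
        by_contra hvb
        rw [hi v hv hva hvb] at hY
        cases hY
      subst hvb
      obtain rfl : c' = Y := by rw [hc'] at hY; exact Option.some.inj hY
      have hr := hreg'.reverse hR
      have hm : ∀ e, e ∈ p.reverse ↔ e ∈ p := fun e => List.mem_reverse
      refine ⟨p.reverse, fun e he => (hm e).1 he, by simpa using hb, List.nodup_reverse.2 hpn,
        Or.inl hr, main _ hm (List.nodup_reverse.2 hpn) hr.1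
          (List.isChain_reverse.2 (hK.imp fun _ _ h => h.symm)) (last p.reverse hm a c
            (by simpa using ha) hc hne.symm fun e he h1 h2 => hi e ((hm e).1 he) h2 h1)⟩
  · have hsemi' := hsemi
    obtain ⟨h1, a, b, c, ha, hb, hc, hS, hX, hi⟩ := hsemi
    have hva : v = a := by
      by_contra hva
      rw [hi v hv hva] at hY
      cases hY
    subst hva
    exact ⟨p, fun e he => he, ha, hpn, Or.inr hsemi', main p (fun _ => Iff.rfl) hpn h1 hK
      fun e he hev hce => absurd (hi e he hev) hce⟩

/-! ### The exchange argument -/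

/-- Regular chains carry two classes and semi-regular ones a single one, so one semi-regular chain
makes the inequality strict. -/
theorem sum_slotCount_eq {S : C → Prop} {Q : List (List E)} (hQn : Q.flatten.Nodup)
    (hQ : ∀ q ∈ Q, Reg R cl q ∨ Semi R cl X S q) {q : List E} (hq : q ∈ Q)
    (hs : Semi R cl X S q) : (Q.map (slotCount cl)).sum < 2 * Q.length := by
  obtain ⟨Q1, Q2, rfl⟩ := List.append_of_mem hq
  have hn := (List.nodup_flatten.1 hQn).1
  have hle : ∀ L : List (List E), (∀ x ∈ L, x ∈ Q1 ++ q :: Q2) →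
      (L.map (slotCount cl)).sum ≤ 2 * L.length := by
    intro L hL
    induction L with
    | nil => simp
    | cons x L ih =>
      have h1 := ih fun y hy => hL y (List.mem_cons_of_mem _ hy)
      have hx := hL x List.mem_cons_self
      have h2 : slotCount cl x ≤ 2 := by
        rcases hQ x hx with h | h
        · exact (h.slotCount (hn x hx)).le
        · rw [h.slotCount (hn x hx)]; omega
      simp only [List.map_cons, List.sum_cons, List.length_cons]
      omega
  have h1 := hle Q1 fun x hx => by simp [hx]
  have h2 := hle Q2 fun x hx => by simp [hx]
  have h3 := hs.slotCount (hn q hq)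
  simp only [List.map_append, List.map_cons, List.sum_append, List.sum_cons, List.length_append,
    List.length_cons]
  omega

theorem exists_slot_notMem {P Q : List (List E)} (hPn : P.flatten.Nodup)
    (h : (Q.map (slotCount cl)).sum < (P.map (slotCount cl)).sum) :
    ∃ p ∈ P, ∃ v ∈ p, v ∉ Q.flatten ∧ ∃ Y, cl v = some Y := by
  classical
  by_contra hcon
  push Not at hcon
  have e1 : ∀ L : List (List E), (L.map (slotCount cl)).sum =
      (L.flatten.filter fun e => decide (cl e ≠ none)).length := by
    intro L
    rw [← List.countP_eq_length_filter, List.countP_flatten]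
    congr 1
  rw [e1, e1] at h
  have hsub : (P.flatten.filter fun e => decide (cl e ≠ none)) ⊆
      (Q.flatten.filter fun e => decide (cl e ≠ none)) := by
    intro v hv
    simp only [List.mem_filter, decide_eq_true_eq] at hv ⊢
    obtain ⟨p, hp, hvp⟩ := List.mem_flatten.1 hv.1
    refine ⟨?_, hv.2⟩
    by_contra hvQ
    obtain ⟨Y, hY⟩ := Option.ne_none_iff_exists'.1 hv.2
    exact hcon p hp v hvp hvQ Y hY
  have := (List.subperm_of_subset (hPn.filter _) hsub).length_le
  omega

/-- One improvement step of a family that still contains chains ending in `X`. -/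
theorem exists_improvement {P : List (List E)} (hR : ∀ e f, R e f → R f e)
    (hX : ∀ e f, X e → X f → e ≠ f → R e f) {s : C}
    (hP : ∀ p ∈ P, Reg R cl p ∨ Semi R cl X (· = s) p) (hPn : P.flatten.Nodup)
    {Q : List (List E)} (hQ : ∀ q ∈ Q, Reg R cl q ∨ Semi R cl X (· ≠ s) q)
    (hQn : Q.flatten.Nodup) (hPQ : 2 * Q.length ≤ (P.map (slotCount cl)).sum)
    {q₀ : List E} (hq₀ : q₀ ∈ Q) (hq₀X : Semi R cl X (· ≠ s) q₀) :
    ∃ q ∈ Q, ∃ q' : List E, q'.Nodup ∧ (∀ e ∈ q', e ∈ q ∨ e ∉ Q.flatten) ∧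
      (Reg R cl q' ∨ Semi R cl X (· ≠ s) q') ∧
      (slotCount cl q < slotCount cl q' ∨ slotCount cl q = slotCount cl q' ∧
        breaks (Consec P) q' < breaks (Consec P) q) := by
  obtain ⟨p, hp, v, hvp, hvQ, Y, hY⟩ := exists_slot_notMem hPn
    (lt_of_lt_of_le (sum_slotCount_eq hQn hQ hq₀ hq₀X) hPQ)
  obtain ⟨p', -, hhead, hn, htype, hlead⟩ := exists_lead_or hR hP hPn hp hvp hY
  -- Only the first meeting with `Q` matters: the part of the lead before it is disjoint from all of
  -- `Q`, so rerouting one chain keeps the family disjoint.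
  have hQnd := (List.nodup_flatten.1 hQn).1
  by_cases hmeet : ∃ h ∈ p', h ∈ Q.flatten
  · obtain ⟨C', h, D, rfl, hh, hC'⟩ := exists_first hmeet
    cases C' with
    | nil => simp at hhead; subst hhead; exact absurd hh hvQ
    | cons a A =>
      obtain rfl : a = v := by simpa using hhead
      have H := hlead A h D rfl
      obtain ⟨q, hq, hhq⟩ := List.mem_flatten.1 hh
      have hd : ∀ e ∈ a :: A, e ∉ q := fun e he heq => hC' e he (List.mem_flatten.2 ⟨q, hq, heq⟩)
      refine ⟨q, hq, ?_⟩
      rcases hQ q hq with hreg | hsemi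
      · obtain ⟨q', h1, h2, h3, h4⟩ := H.reroute_reg hR (hQnd q hq) hreg hhq hd
        refine ⟨q', h1, fun e he => ?_, Or.inl h2, Or.inr ⟨?_, h4⟩⟩
        · rcases h3 e he with h | h
          · exact Or.inl h
          · exact Or.inr (hC' e h)
        · rw [hreg.slotCount (hQnd q hq), h2.slotCount h1]
      · have hqn := hQnd q hq
        have hsl := hsemi.slotCount hqn
        obtain ⟨hc, y, z, t, hy, hz, hcy, hts, hzX, hi⟩ := hsemi
        obtain ⟨A', B, rfl⟩ := List.append_of_mem hhq
        -- With equal classes the route from `v` must continue to the `X`-end, and only breaks can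
        -- improve. With different classes it turns back along the chain to `y`, and the result is
        -- regular.
        by_cases hYt : Y = t
        · subst hYt
          rcases H.reroute hqn hc hy hz (by simp [hcy]) (fun e he h1 _ => hi e he h1) hd with
            h | h
          · obtain ⟨k1, k2, k3, k4, k5, k6⟩ := h
            have hsem : Semi R cl X (· ≠ s) (a :: A ++ h :: B) := by
              refine ⟨k2, a, z, Y, by simp, k3, hY, hts, hzX, fun e he hea => ?_⟩
              by_cases hez : e = z
              · subst hez
                refine hi e (List.mem_of_getLast? hz) ?_
                rintro rfl
                exact k5 he
              · exact k4 e he hea hez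
            refine ⟨_, k1, fun e he => ?_, Or.inr hsem, Or.inr ⟨?_, k6⟩⟩
            · rcases List.mem_append.1 he with h | h
              · exact Or.inr (hC' e h)
              · exact Or.inl (List.mem_append_right _ h)
            · rw [hsl, hsem.slotCount k1]
          · exact absurd hcy h.2
        · have hr : (B.reverse ++ h :: A'.reverse).IsChain R := by
            have := List.isChain_reverse.2 (hc.imp fun _ _ h => hR _ _ h)
            simpa using this
          have hA := H.none_of_mem
          have k1 : (a :: A ++ h :: A'.reverse).Nodup := by
            have h1 := H.nodup
            have h2 : (B.reverse ++ h :: A'.reverse).Nodup := by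
              simpa using List.nodup_reverse.2 hqn
            rw [List.nodup_append'] at h1 h2 ⊢
            refine ⟨h1.1, h2.2.1, fun e he he' => hd e he ?_⟩
            simp at he' ⊢; tauto
          have hreg : Reg R cl (a :: A ++ h :: A'.reverse) := by
            refine ⟨chain_splice H.chain hr, a, y, Y, t, by simp, ?_, hY, hcy, hYt, ?_⟩
            · rw [List.getLast?_append]
              cases A' with
              | nil => simpa using hy
              | cons b A' => simpa [List.getLast?_cons] using hy
            · intro e he h1 h2
              simp only [List.mem_append, List.mem_cons, List.mem_reverse] at he
              rcases he with (he | he) | he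
              · exact absurd he h1
              · exact hA e he
              · exact hi e (by simp; tauto) h2
          refine ⟨_, k1, fun e he => ?_, Or.inl hreg, Or.inl ?_⟩
          · rcases List.mem_append.1 he with h | h
            · exact Or.inr (hC' e h)
            · left; simp at h ⊢; tauto
          · rw [hsl, hreg.slotCount k1]; omega
  · push Not at hmeet
    have hq₀n := hQnd q₀ hq₀
    refine ⟨q₀, hq₀, ?_⟩
    rw [hq₀X.slotCount hq₀n]
    -- Without a meeting, a regular `p'` simply replaces `q₀`. A semi-regular one runs from `s` to
    -- `X` and is glued through the clique `X` to `q₀`, whose class is not `s`.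
    rcases htype with hreg | hleg
    · refine ⟨p', hn, fun e he => Or.inr (hmeet e he), Or.inl hreg, Or.inl ?_⟩
      rw [hreg.slotCount hn]; omega
    · obtain ⟨h1, a, b, c, ha, hb, hc, hS, hbX, hi⟩ := hleg
      obtain ⟨g1, a', b', c', ha', hb', hc', hS', hbX', hi'⟩ := hq₀X
      have hdis : ∀ e ∈ p', e ∉ q₀ := fun e he he' => hmeet e he (List.mem_flatten.2 ⟨q₀, hq₀, he'⟩)
      have k1 : (p' ++ q₀.reverse).Nodup := by
        rw [List.nodup_append']
        exact ⟨hn, List.nodup_reverse.2 hq₀n, fun e he he' => hdis e he (List.mem_reverse.1 he')⟩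
      have hreg : Reg R cl (p' ++ q₀.reverse) := by
        refine ⟨h1.append (List.isChain_reverse.2 (g1.imp fun _ _ h => hR _ _ h)) ?_, a, a', c, c',
          by simp [ha], by simp [ha'], hc, hc', ?_, ?_⟩
        · intro x hx y hy
          rw [hb] at hx
          rw [List.head?_reverse, hb'] at hy
          simp at hx hy
          subst hx hy
          refine hX _ _ hbX hbX' ?_
          rintro rfl
          exact hdis _ (List.mem_of_getLast? hb) (List.mem_of_getLast? hb')
        · rintro rfl
          exact hS' hS
        · intro e he h1 h2
          rcases List.mem_append.1 he with he | he
          · exact hi e he h1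
          · exact hi' e (List.mem_reverse.1 he) h2
      refine ⟨_, k1, fun e he => ?_, Or.inl hreg, Or.inl ?_⟩
      · rcases List.mem_append.1 he with he | he
        · exact Or.inr (hmeet e he)
        · exact Or.inl (List.mem_reverse.1 he)
      · rw [hreg.slotCount k1]; omega

/-- If a family `P` of disjoint chains, each joining two classes or joining class `s` to the clique
`X`, has `2k` ends with a class, and there are `k` disjoint chains, each joining two classes or
joining a class other than `s` to `X`, then there are `k` disjoint chains joining two classes. -/
theorem exists_all_reg {P : List (List E)} (hR : ∀ e f, R e f → R f e)
    (hX : ∀ e f, X e → X f → e ≠ f → R e f) {s : C}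
    (hP : ∀ p ∈ P, Reg R cl p ∨ Semi R cl X (· = s) p) (hPn : P.flatten.Nodup)
    {Q : List (List E)} (hQ : ∀ q ∈ Q, Reg R cl q ∨ Semi R cl X (· ≠ s) q)
    (hQn : Q.flatten.Nodup) (hPQ : 2 * Q.length ≤ (P.map (slotCount cl)).sum) :
    ∃ Q' : List (List E), Q'.length = Q.length ∧ (∀ q ∈ Q', Reg R cl q) ∧ Q'.flatten.Nodup := by
  -- Lexicographic induction: the number of missing slots first, the number of breaks second.
  generalize hm : 2 * Q.length - (Q.map (slotCount cl)).sum = m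
  induction m using Nat.strong_induction_on generalizing Q with
  | _ m ihm =>
  generalize hb : (Q.map (breaks (Consec P))).sum = b
  induction b using Nat.strong_induction_on generalizing Q with
  | _ b ihb =>
  by_cases hall : ∀ q ∈ Q, Reg R cl q
  · exact ⟨Q, rfl, hall, hQn⟩
  · push Not at hall
    obtain ⟨q₀, hq₀, hnr⟩ := hall
    have hq₀X := (hQ q₀ hq₀).resolve_left hnr
    have hlt := sum_slotCount_eq hQn hQ hq₀ hq₀X
    obtain ⟨q, hq, q', hn', hm', ht', hprog⟩ :=
      exists_improvement hR hX hP hPn hQ hQn hPQ hq₀ hq₀X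
    obtain ⟨Q', hlen, hQn', hmem, hsum⟩ := exists_replace hQn hq hn' hm'
    have hQ' : ∀ x ∈ Q', Reg R cl x ∨ Semi R cl X (· ≠ s) x := by
      intro x hx
      rcases hmem x hx with rfl | h
      · exact ht'
      · exact hQ x h
    have hs1 := hsum (slotCount cl)
    have hs2 := hsum (breaks (Consec P))
    rcases hprog with hprog | ⟨h1, h2⟩
    · obtain ⟨Q'', h3, h4⟩ := ihm (2 * Q'.length - (Q'.map (slotCount cl)).sum) (by omega) hQ' hQn'
        (by omega) rfl
      exact ⟨Q'', h3.trans hlen, h4⟩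
    · obtain ⟨Q'', h3, h4⟩ := ihb _ (by omega) hQ' hQn' (by omega) (by omega) rfl
      exact ⟨Q'', h3.trans hlen, h4⟩

end

/-! ### Networks of inner vertices and terminal classes -/

section

variable {V C E : Type*}

/-- `g` assigns to both ends of every edge an inner vertex or a terminal class. This is the class
of an edge with precisely one terminal end. -/
def slotClass (g : E → Bool → V ⊕ C) (e : E) : Option C :=
  match g e false, g e true with
  | .inl _, .inr c => some c
  | .inr c, .inl _ => some c
  | _, _ => none

/-- The inner end of an edge with precisely one terminal end. -/
def slotBase (g : E → Bool → V ⊕ C) (e : E) : Option V :=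
  match g e false, g e true with
  | .inl v, .inr _ => some v
  | .inr _, .inl v => some v
  | _, _ => none

/-- Two edges share an inner vertex. -/
def EdgeAdj (g : E → Bool → V ⊕ C) (e f : E) : Prop :=
  ∃ v i j, g e i = .inl v ∧ g f j = .inl v

/-- An edge joins two inner vertices. -/
def Links (g : E → Bool → V ⊕ C) (e : E) (a b : V) : Prop :=
  ∃ i, g e i = .inl a ∧ g e (!i) = .inl b

/-- Extends an assignment of inner vertices to classes (`inl`) and blocks (`inr`) to ends. -/
def ext (φ : V → C ⊕ V) : V ⊕ C → C ⊕ V := Sum.elim φ Sum.inl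

/-- The number of edge ends leaving a class, over the edges with an inner end. -/
noncomputable def weight (g : E → Bool → V ⊕ C) (φ : V → C ⊕ V) : ℕ :=
  {d : E × Bool | (∃ i v, g d.1 i = .inl v) ∧ (ext φ (g d.1 d.2)).isLeft ∧
    ext φ (g d.1 (!d.2)) ≠ ext φ (g d.1 d.2)}.ncard

/-- The number of edge ends leaving a part. -/
noncomputable def boundary (g : E → Bool → V ⊕ C) (φ : V → C ⊕ V) (p : C ⊕ V) : ℕ :=
  {d : E × Bool | ext φ (g d.1 d.2) = p ∧ ext φ (g d.1 (!d.2)) ≠ p}.ncard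

/-- The number of blocks with odd boundary. -/
noncomputable def oddBlocks (g : E → Bool → V ⊕ C) (φ : V → C ⊕ V) : ℕ :=
  {b : V | Odd (boundary g φ (.inr b))}.ncard

/-- Two unassigned vertices are joined by an edge. -/
def Step (g : E → Bool → V ⊕ C) (φ : V → C ⊕ V) (a b : V) : Prop :=
  (∃ e, Links g e a b) ∧ (φ a).isRight ∧ (φ b).isRight

/-- The blocks are the connected components of the unassigned vertices, and all classes occur. -/
structure Valid (g : E → Bool → V ⊕ C) (φ : V → C ⊕ V) : Prop where
  connected : ∀ a b c d, φ a = .inr c → φ b = .inr d →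
    (c = d ↔ Relation.ReflTransGen (Step g φ) a b)
  present : ∀ v c, φ v = .inl c → ∃ e i, g e i = .inr c

variable {g : E → Bool → V ⊕ C}

theorem slotClass_eq_some {e : E} {c : C} :
    slotClass g e = some c ↔ ∃ i v, g e i = .inr c ∧ g e (!i) = .inl v := by
  unfold slotClass
  rcases h1 : g e false with v | c1 <;> rcases h2 : g e true with w | c2 <;>
    simp [h1, h2]

theorem slotBase_eq_some {e : E} {v : V} :
    slotBase g e = some v ↔ ∃ i c, g e i = .inr c ∧ g e (!i) = .inl v := by
  unfold slotBase
  rcases h1 : g e false with v | c1 <;> rcases h2 : g e true with w | c2 <;>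
    simp [h1, h2]

theorem slotClass_ne_none_iff {e : E} : slotClass g e ≠ none ↔ ∃ v, slotBase g e = some v := by
  unfold slotBase slotClass
  rcases h1 : g e false with v | c1 <;> rcases h2 : g e true with w | c2 <;> simp

theorem EdgeAdj.symm {e f : E} (h : EdgeAdj g e f) : EdgeAdj g f e := by
  obtain ⟨v, i, j, h1, h2⟩ := h
  exact ⟨v, j, i, h2, h1⟩

theorem Links.symm {e : E} {a b : V} (h : Links g e a b) : Links g e b a := by
  obtain ⟨i, h1, h2⟩ := h
  exact ⟨!i, h2, by simpa using h1⟩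

theorem Links.slotClass_eq {e : E} {a b : V} (h : Links g e a b) : slotClass g e = none := by
  obtain ⟨i, h1, h2⟩ := h
  unfold slotClass
  cases i <;> simp at h2 <;> simp [h1, h2]

theorem Links.eq_or_eq {e : E} {a b c d : V} (h : Links g e a b) (h' : Links g e c d) :
    a = c ∧ b = d ∨ a = d ∧ b = c := by
  obtain ⟨i, h1, h2⟩ := h
  obtain ⟨j, h3, h4⟩ := h'
  cases i <;> cases j <;> simp_all

/-! ### Pairing terminal edges by edge-disjoint linkages -/

/-- A walk through inner vertices, given by its edges. -/
inductive IsWalk (g : E → Bool → V ⊕ C) : V → List E → V → Prop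
  | nil (a : V) : IsWalk g a [] a
  | cons {a b c : V} {e : E} {l : List E} (h : Links g e a b) (w : IsWalk g b l c) :
    IsWalk g a (e :: l) c

theorem IsWalk.append {a b c : V} {l m : List E} (h : IsWalk g a l b) (h' : IsWalk g b m c) :
    IsWalk g a (l ++ m) c := by
  induction h with
  | nil => exact h'
  | cons h _ ih => exact .cons h (ih h')

theorem IsWalk.reverse {a b : V} {l : List E} (h : IsWalk g a l b) : IsWalk g b l.reverse a := by
  induction h with
  | nil => exact .nil _
  | cons h _ ih =>
    rw [List.reverse_cons]
    exact ih.append (.cons h.symm (.nil _))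

theorem IsWalk.split {a b : V} {A B : List E} {h : E} (w : IsWalk g a (A ++ h :: B) b) :
    ∃ p q, IsWalk g a A p ∧ Links g h p q ∧ IsWalk g q B b := by
  induction A generalizing a with
  | nil =>
    cases w with
    | cons h w => exact ⟨_, _, .nil _, h, w⟩
  | cons e A ih =>
    cases w with
    | cons h w =>
      obtain ⟨p, q, h1, h2, h3⟩ := ih w
      exact ⟨p, q, .cons h h1, h2, h3⟩

theorem IsWalk.slotClass_eq {a b : V} {l : List E} (w : IsWalk g a l b) :
    ∀ e ∈ l, slotClass g e = none := by
  induction w with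
  | nil => simp
  | cons h _ ih =>
    intro e he
    rcases List.mem_cons.1 he with rfl | he
    · exact h.slotClass_eq
    · exact ih e he

/-- If an edge is traversed twice in the same direction, the closed part in between is skipped. In
opposite directions both traversals are dropped as well. -/
theorem IsWalk.exists_shorter {a b : V} {l : List E} (w : IsWalk g a l b) (hl : ¬ l.Nodup) :
    ∃ l', IsWalk g a l' b ∧ l'.length < l.length := by
  induction w with
  | nil => simp at hl
  | @cons a b c e l h w ih =>
    by_cases he : e ∈ l
    · obtain ⟨A, B, rfl⟩ := List.append_of_mem he
      obtain ⟨p, q, h1, h2, h3⟩ := w.split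
      rcases h.eq_or_eq h2 with ⟨rfl, rfl⟩ | ⟨rfl, rfl⟩
      · exact ⟨_, .cons h h3, by simp⟩
      · exact ⟨_, h3, by simp; omega⟩
    · obtain ⟨l', h1, h2⟩ := ih (by simpa [he] using hl)
      exact ⟨_, .cons h h1, by simpa using h2⟩

/-- The edges of a walk joining two terminals, all of whose internal vertices are inner. -/
def IsLinkage (g : E → Bool → V ⊕ C) (l : List E) : Prop :=
  ∃ u m v a b, l = u :: (m ++ [v]) ∧ slotBase g u = some a ∧ slotBase g v = some b ∧ IsWalk g a m b

open Classical in
/-- The sublist of edges with precisely one terminal end. -/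
noncomputable def slots (g : E → Bool → V ⊕ C) (l : List E) : List E :=
  l.filter fun e => decide (slotClass g e ≠ none)

theorem mem_slots {l : List E} {e : E} : e ∈ slots g l ↔ e ∈ l ∧ slotClass g e ≠ none := by
  simp [slots]

theorem slots_append (l m : List E) : slots g (l ++ m) = slots g l ++ slots g m := by
  simp [slots]

theorem slots_linkage {u v : E} {m : List E} {a b : V} (hu : slotBase g u = some a)
    (hv : slotBase g v = some b) (w : IsWalk g a m b) : slots g (u :: (m ++ [v])) = [u, v] := by
  have h1 := slotClass_ne_none_iff.2 ⟨a, hu⟩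
  have h2 := slotClass_ne_none_iff.2 ⟨b, hv⟩
  have h3 : slots g m = [] := by
    rw [slots, List.filter_eq_nil_iff]
    intro e he
    simp [w.slotClass_eq e he]
  simp only [slots] at h3 ⊢
  rw [List.filter_cons_of_pos (by simpa using h1), List.filter_append, h3,
    List.filter_cons_of_pos (by simpa using h2)]
  rfl

theorem exists_cons_perm_of_mem {α : Type*} {a : α} {l : List α} (h : a ∈ l) :
    ∃ m, (a :: m).Perm l := by
  obtain ⟨s, t, rfl⟩ := List.append_of_mem h
  exact ⟨s ++ t, List.perm_middle.symm⟩

theorem exists_perm_of_not_pairwise {α : Type*} {R : α → α → Prop} {l : List α}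
    (h : ¬ l.Pairwise R) : ∃ a b m, l.Perm (a :: b :: m) ∧ ¬ R a b := by
  induction l with
  | nil => simp at h
  | cons a l ih =>
    by_cases ha : ∀ b ∈ l, R a b
    · obtain ⟨x, y, m, h1, h2⟩ := ih (fun h' => h (List.pairwise_cons.2 ⟨ha, h'⟩))
      refine ⟨x, y, a :: m, (h1.cons a).trans ?_, h2⟩
      exact (List.Perm.swap _ _ _).trans ((List.Perm.swap _ _ _).cons _)
    · push Not at ha
      obtain ⟨b, hb, hab⟩ := ha
      obtain ⟨m, hm⟩ := exists_cons_perm_of_mem hb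
      exact ⟨a, b, m, (hm.symm.cons a), hab⟩

/-- A family of linkages with distinct ends. -/
def IsPairing (g : E → Bool → V ⊕ C) (F : List (List E)) : Prop :=
  (∀ l ∈ F, IsLinkage g l) ∧ (slots g F.flatten).Nodup

theorem IsPairing.perm {F F' : List (List E)} (h : IsPairing g F) (hp : F.Perm F') :
    IsPairing g F' :=
  ⟨fun l hl => h.1 l (hp.mem_iff.2 hl), (hp.flatten.filter _).nodup_iff.1 h.2⟩

theorem IsPairing.length_slots {F : List (List E)} (h : IsPairing g F) :
    (slots g F.flatten).length = 2 * F.length := by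
  have h1 := h.1
  clear h
  induction F with
  | nil => simp [slots]
  | cons l F ih =>
    obtain ⟨u, m, v, a, b, rfl, hu, hv, w⟩ := h1 l (by simp)
    rw [List.flatten_cons, slots_append, List.length_append,
      ih fun l hl => h1 l (List.mem_cons_of_mem _ hl), slots_linkage hu hv w]
    simp; omega

theorem IsPairing.replace {F : List (List E)} {l l' : List E} (h : IsPairing g (l :: F))
    (hl : IsLinkage g l') (hs : (slots g l').Perm (slots g l)) : IsPairing g (l' :: F) := by
  refine ⟨?_, ?_⟩
  · intro x hx
    rcases List.mem_cons.1 hx with rfl | hx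
    · exact hl
    · exact h.1 x (List.mem_cons_of_mem _ hx)
  · have := h.2
    rw [List.flatten_cons, slots_append] at this ⊢
    exact (hs.append_right _).nodup_iff.2 this

/-- A repetition inside one linkage is shortcut. An edge common to two linkages is removed from both
and the four loose pieces are reconnected; which terminal edges get paired is irrelevant, so either
direction of traversal is fine. -/
theorem IsPairing.exists_shorter {F : List (List E)} (h : IsPairing g F)
    (hn : ¬ F.flatten.Nodup) :
    ∃ F', IsPairing g F' ∧ F'.length = F.length ∧ F'.flatten.length < F.flatten.length := by
  rw [List.nodup_flatten, not_and_or] at hn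
  rcases hn with hn | hn
  · push Not at hn
    obtain ⟨l, hl, hln⟩ := hn
    obtain ⟨F0, hp⟩ := exists_cons_perm_of_mem hl
    have hp := hp.symm
    have hF := h.perm hp
    obtain ⟨u, m, v, a, b, rfl, hu, hv, w⟩ := h.1 l hl
    have hm : ¬ m.Nodup := by
      intro hm
      apply hln
      have h1 := hF.2
      rw [List.flatten_cons, slots_append, slots_linkage hu hv w] at h1
      have huv : u ≠ v := by rintro rfl; simp at h1
      have hum : u ∉ m := fun h =>
        slotClass_ne_none_iff.2 ⟨a, hu⟩ (w.slotClass_eq u h)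
      have hvm : v ∉ m := fun h =>
        slotClass_ne_none_iff.2 ⟨b, hv⟩ (w.slotClass_eq v h)
      rw [List.nodup_cons, List.nodup_append']
      simp [huv, hum, hvm, hm]
    obtain ⟨m', w', hlen⟩ := w.exists_shorter hm
    refine ⟨(u :: (m' ++ [v])) :: F0, hF.replace ⟨u, m', v, a, b, rfl, hu, hv, w'⟩ ?_, ?_, ?_⟩
    · rw [slots_linkage hu hv w, slots_linkage hu hv w']
    · simpa using hp.length_eq.symm
    · rw [hp.flatten.length_eq]; simpa using hlen
  · obtain ⟨l₁, l₂, F0, hp, hd⟩ := exists_perm_of_not_pairwise hn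
    have hF := h.perm hp
    obtain ⟨u₁, m₁, v₁, a₁, b₁, rfl, hu₁, hv₁, w₁⟩ := hF.1 l₁ (by simp)
    obtain ⟨u₂, m₂, v₂, a₂, b₂, rfl, hu₂, hv₂, w₂⟩ := hF.1 l₂ (by simp)
    have hsn := hF.2
    rw [List.flatten_cons, slots_append, List.flatten_cons, slots_append] at hsn
    have hs1 := slots_linkage hu₁ hv₁ w₁
    have hs2 := slots_linkage hu₂ hv₂ w₂
    obtain ⟨e, he₁, he₂⟩ : ∃ e, e ∈ m₁ ∧ e ∈ m₂ := by
      simp only [List.Disjoint] at hd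
      push Not at hd
      obtain ⟨e, he₁, he₂, -⟩ := hd
      have hes : slotClass g e = none := by
        by_contra hes
        rw [List.nodup_append'] at hsn
        exact hsn.2.2 (mem_slots.2 ⟨he₁, hes⟩) (List.mem_append_left _ (mem_slots.2 ⟨he₂, hes⟩))
      have hne : ∀ {u a}, slotBase g u = some a → e ≠ u := by
        rintro u a hu rfl
        exact slotClass_ne_none_iff.2 ⟨a, hu⟩ hes
      refine ⟨e, ?_, ?_⟩
      · simpa [hne hu₁, hne hv₁] using he₁
      · simpa [hne hu₂, hne hv₂] using he₂
    obtain ⟨A₁, B₁, rfl⟩ := List.append_of_mem he₁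
    obtain ⟨A₂, B₂, rfl⟩ := List.append_of_mem he₂
    obtain ⟨p₁, q₁, k₁, e₁, j₁⟩ := w₁.split
    obtain ⟨p₂, q₂, k₂, e₂, j₂⟩ := w₂.split
    rw [hs1, hs2] at hsn
    have fin : ∀ {x y z t a b c d m n}, slotBase g x = some a → slotBase g y = some b →
        IsWalk g a m b → slotBase g z = some c → slotBase g t = some d → IsWalk g c n d →
        [x, y, z, t].Perm [u₁, v₁, u₂, v₂] →
        m.length + n.length < (A₁ ++ e :: B₁).length + (A₂ ++ e :: B₂).length →
        ∃ F', IsPairing g F' ∧ F'.length = F.length ∧ F'.flatten.length < F.flatten.length := by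
      intro x y z t a b c d m n hx hy wm hz ht wn hperm hlen
      refine ⟨(x :: (m ++ [y])) :: (z :: (n ++ [t])) :: F0, ⟨?_, ?_⟩, ?_, ?_⟩
      · intro l hl
        rcases List.mem_cons.1 hl with rfl | hl
        · exact ⟨x, m, y, a, b, rfl, hx, hy, wm⟩
        rcases List.mem_cons.1 hl with rfl | hl
        · exact ⟨z, n, t, c, d, rfl, hz, ht, wn⟩
        · exact hF.1 l (by simp [hl])
      · rw [List.flatten_cons, slots_append, List.flatten_cons, slots_append,
          slots_linkage hx hy wm, slots_linkage hz ht wn, ← List.append_assoc]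
        rw [← List.append_assoc] at hsn
        exact (hperm.append_right _).nodup_iff.2 hsn
      · simpa using hp.length_eq.symm
      · rw [hp.flatten.length_eq]
        simp only [List.flatten_cons, List.length_append, List.length_cons, List.length_nil]
          at hlen ⊢
        omega
    rcases e₁.eq_or_eq e₂ with ⟨rfl, rfl⟩ | ⟨rfl, rfl⟩
    · refine fin hu₁ hu₂ (k₁.append k₂.reverse) hv₁ hv₂ (j₁.reverse.append j₂) ?_ (by simp; omega)
      exact (List.Perm.swap _ _ _).cons _
    · refine fin hu₁ hv₂ (k₁.append j₂) hu₂ hv₁ (k₂.append j₁) ?_ (by simp; omega)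
      refine List.Perm.cons _ ?_
      exact List.perm_append_comm (l₁ := [v₂, u₂]) (l₂ := [v₁]) |>.trans
        ((List.Perm.swap _ _ _).cons _)

/-- A family of edge-disjoint linkages leaving no two unused terminal edges connected. -/
theorem exists_disjoint_pairing [Finite E] (g : E → Bool → V ⊕ C) :
    ∃ F, IsPairing g F ∧ F.flatten.Nodup ∧ ∀ u v a b m, slotBase g u = some a →
      slotBase g v = some b → IsWalk g a m b → u ∉ F.flatten → v ∉ F.flatten → u = v := by
  classical
  have := Fintype.ofFinite E
  -- Minimality means as many linkages as possible, and then least total length. Disjointness is not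
  -- demanded when comparing, so a linkage may be added even if it overlaps the others.
  have hwf : WellFounded (InvImage (Prod.Lex (· < ·) (· < ·)) fun F : List (List E) =>
      (Fintype.card E - F.length, F.flatten.length)) :=
    InvImage.wf _ (WellFounded.prod_lex wellFounded_lt wellFounded_lt)
  obtain ⟨F, hF, hmin⟩ := hwf.has_min {F | IsPairing g F} ⟨[], by simp [IsPairing, slots]⟩
  refine ⟨F, hF, ?_, ?_⟩
  · by_contra hn
    obtain ⟨F', h1, h2, h3⟩ := IsPairing.exists_shorter hF hn
    refine hmin F' h1 ?_
    simp only [InvImage, h2]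
    exact Prod.Lex.right _ h3
  · intro u v a b m hu hv w hu' hv'
    by_contra huv
    have hF' : IsPairing g ((u :: (m ++ [v])) :: F) := by
      refine ⟨?_, ?_⟩
      · intro l hl
        rcases List.mem_cons.1 hl with rfl | hl
        · exact ⟨u, m, v, a, b, rfl, hu, hv, w⟩
        · exact hF.1 l hl
      · rw [List.flatten_cons, slots_append, slots_linkage hu hv w, List.nodup_append']
        refine ⟨by simpa using huv, hF.2, ?_⟩
        intro e he he'
        have := (mem_slots.1 he').1
        simp at he
        rcases he with rfl | rfl <;> contradiction
    refine hmin _ hF' ?_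
    have h1 := hF'.length_slots
    have h2 : (slots g ((u :: (m ++ [v])) :: F).flatten).length ≤ Fintype.card E :=
      hF'.2.length_le_card
    simp only [InvImage]
    refine Prod.Lex.left _ _ ?_
    simp only [List.length_cons] at h1 ⊢
    omega

end

/-! ### The base case: at most one terminal edge per class -/

section

variable {V C E : Type*} {g : E → Bool → V ⊕ C}

/-- The nontrivial half of the min-max relation, for edge-disjoint chains of edges. -/
def HasMinMax (g : E → Bool → V ⊕ C) : Prop :=
  ∃ (L : List (List E)) (φ : V → C ⊕ V), (∀ l ∈ L, Reg (EdgeAdj g) (slotClass g) l) ∧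
    L.flatten.Nodup ∧ Valid g φ ∧ weight g φ ≤ 2 * L.length + oddBlocks g φ

theorem slotBase_eq_none_of_slotClass {e : E} (h : slotClass g e = none) : slotBase g e = none := by
  by_contra hne
  obtain ⟨v, hv⟩ := Option.ne_none_iff_exists'.1 hne
  exact slotClass_ne_none_iff.2 ⟨v, hv⟩ h

theorem IsWalk.isChain {a b : V} {m : List E} (w : IsWalk g a m b) {v : E}
    (hv : slotBase g v = some b) :
    (m ++ [v]).IsChain (EdgeAdj g) ∧ ∃ e ∈ (m ++ [v]).head?, ∃ i, g e i = .inl a := by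
  induction w with
  | nil a =>
    obtain ⟨i, c, -, h⟩ := slotBase_eq_some.1 hv
    exact ⟨by simp, v, by simp, _, h⟩
  | @cons a b c e l h w ih =>
    obtain ⟨h1, f, hf, i, hi⟩ := ih hv
    obtain ⟨j, hj, hj'⟩ := h
    refine ⟨?_, e, by simp, j, hj⟩
    rw [List.cons_append, List.isChain_cons]
    refine ⟨fun y hy => ?_, h1⟩
    obtain rfl : f = y := Option.mem_unique hf hy
    exact ⟨b, _, i, hj', hi⟩

theorem IsLinkage.reg
    (hinj : ∀ e f c, slotClass g e = some c → slotClass g f = some c → e = f) {l : List E}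
    (h : IsLinkage g l) (hl : l.Nodup) : Reg (EdgeAdj g) (slotClass g) l := by
  obtain ⟨u, m, v, a, b, rfl, hu, hv, w⟩ := h
  obtain ⟨c, hc⟩ := Option.ne_none_iff_exists'.1 (slotClass_ne_none_iff.2 ⟨a, hu⟩)
  obtain ⟨d, hd⟩ := Option.ne_none_iff_exists'.1 (slotClass_ne_none_iff.2 ⟨b, hv⟩)
  obtain ⟨h1, f, hf, i, hi⟩ := w.isChain hv
  refine ⟨?_, u, v, c, d, by simp, by simp [List.getLast?_cons], hc, hd, ?_, ?_⟩
  · rw [List.isChain_cons]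
    refine ⟨fun y hy => ?_, h1⟩
    obtain rfl : f = y := Option.mem_unique hf hy
    obtain ⟨j, _, -, hj⟩ := slotBase_eq_some.1 hu
    exact ⟨a, _, i, hj, hi⟩
  · rintro rfl
    obtain rfl := hinj u v c hc hd
    simp at hl
  · intro e he h1 h2
    refine w.slotClass_eq e ?_
    simpa [h1, h2] using he

theorem even_countP_flatten {F : List (List E)} {p : E → Bool} (h : ∀ l ∈ F, Even (l.countP p)) :
    Even (F.flatten.countP p) := by
  induction F with
  | nil => simp
  | cons l F ih =>
    rw [List.flatten_cons, List.countP_append]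
    exact (h l (by simp)).add (ih fun x hx => h x (List.mem_cons_of_mem _ hx))

/-- No vertex is assigned to a class, and the blocks are the components of the inner vertices, named
by representatives. Then `weight` is at most the number of terminal edges, and each one left
unpaired is alone in its component, whose boundary is therefore odd. -/
theorem hasMinMax_of_injective [Finite E]
    (hinj : ∀ e f c, slotClass g e = some c → slotClass g f = some c → e = f) : HasMinMax g := by
  classical
  obtain ⟨F, hF, hFn, hFc⟩ := exists_disjoint_pairing g
  let S : Setoid V := ⟨fun a b => ∃ m, IsWalk g a m b, fun a => ⟨[], .nil a⟩,
    fun ⟨m, h⟩ => ⟨_, h.reverse⟩, fun ⟨m, h⟩ ⟨n, h'⟩ => ⟨_, h.append h'⟩⟩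
  let rep : V → V := fun v => (Quotient.mk S v).out
  have hrep : ∀ a b, rep a = rep b ↔ ∃ m, IsWalk g a m b := by
    intro a b
    constructor
    · intro h
      have : Quotient.mk S a = Quotient.mk S b := by
        rw [← (Quotient.mk S a).out_eq, ← (Quotient.mk S b).out_eq]
        exact congrArg _ h
      exact Quotient.exact this
    · intro h
      have : Quotient.mk S a = Quotient.mk S b := Quotient.sound h
      simp only [rep, this]
  let φ : V → C ⊕ V := fun v => .inr (rep v)
  have hlink : ∀ e i a b, g e i = .inl a → g e (!i) = .inl b → rep a = rep b := fun e i a b h1 h2 =>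
    (hrep a b).2 ⟨[e], .cons ⟨i, h1, h2⟩ (.nil _)⟩
  have hvalid : Valid g φ := by
    refine ⟨?_, fun v c h => by simp [φ] at h⟩
    intro a b c d hc hd
    simp only [φ, Sum.inr.injEq] at hc hd
    subst hc hd
    rw [hrep]
    constructor
    · rintro ⟨m, w⟩
      induction w with
      | nil => exact .refl
      | cons h _ ih => exact .head ⟨⟨_, h⟩, rfl, rfl⟩ ih
    · intro h
      induction h with
      | refl => exact ⟨_, .nil _⟩
      | tail _ h ih =>
        obtain ⟨m, w⟩ := ih
        obtain ⟨⟨e, h⟩, -⟩ := h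
        exact ⟨_, w.append (.cons h (.nil _))⟩
  refine ⟨F, φ, fun l hl => (hF.1 l hl).reg hinj ((List.nodup_flatten.1 hFn).1 l hl), hFn, hvalid, ?_⟩
  let U : Set E := {e | slotClass g e ≠ none ∧ e ∉ F.flatten}
  have h1 : weight g φ ≤ ({e | slotClass g e ≠ none} : Set E).ncard := by
    have key : ∀ d : E × Bool, d ∈ {d : E × Bool | (∃ i v, g d.1 i = .inl v) ∧
        (ext φ (g d.1 d.2)).isLeft ∧ ext φ (g d.1 (!d.2)) ≠ ext φ (g d.1 d.2)} →
        ∃ c v, g d.1 d.2 = .inr c ∧ g d.1 (!d.2) = .inl v := by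
      rintro ⟨e, i⟩ ⟨⟨j, v, hj⟩, h2, -⟩
      simp only at *
      rcases h : g e i with w | c
      · rw [h] at h2; simp [ext, φ] at h2
      · refine ⟨c, v, rfl, ?_⟩
        have : j ≠ i := by
          rintro rfl
          rw [hj] at h
          cases h
        rw [← Bool.eq_not_of_ne this, hj]
    refine Set.ncard_le_ncard_of_injOn Prod.fst ?_ ?_ (Set.toFinite _)
    · intro d hd
      obtain ⟨c, v, h1, h2⟩ := key d hd
      exact slotClass_ne_none_iff.2 ⟨v, slotBase_eq_some.2 ⟨_, c, h1, h2⟩⟩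
    · rintro ⟨e, i⟩ hd ⟨e', i'⟩ hd' heq
      obtain ⟨c, v, h1, h2⟩ := key _ hd
      obtain ⟨c', v', h1', h2'⟩ := key _ hd'
      simp only at heq h1 h2 h1' h2'
      subst heq
      have : i = i' := by
        by_contra hne
        rw [Bool.eq_not_of_ne hne, Bool.not_not, h1'] at h2
        cases h2
      rw [this]
  have h2 : ({e | slotClass g e ≠ none} : Set E).ncard ≤ 2 * F.length + U.ncard := by
    have hsub : {e | slotClass g e ≠ none} ⊆ ((slots g F.flatten).toFinset : Set E) ∪ U := by
      intro e he
      by_cases h : e ∈ F.flatten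
      · left; simpa using mem_slots.2 ⟨h, he⟩
      · exact Or.inr ⟨he, h⟩
    refine (Set.ncard_le_ncard hsub (Set.toFinite _)).trans ((Set.ncard_union_le _ _).trans ?_)
    rw [Set.ncard_coe_finset]
    have := List.toFinset_card_le (slots g F.flatten)
    have := hF.length_slots
    omega
  have h3 : U.ncard ≤ oddBlocks g φ := by
    have hfin : {b : V | Odd (boundary g φ (.inr b))}.Finite := by
      have hsub : {b : V | Odd (boundary g φ (.inr b))} ⊆
          Sum.inr ⁻¹' (Set.range fun d : E × Bool => ext φ (g d.1 d.2)) := by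
        intro b hb
        obtain ⟨d, hd⟩ := Set.nonempty_of_ncard_ne_zero (s := {d : E × Bool |
          ext φ (g d.1 d.2) = .inr b ∧ ext φ (g d.1 (!d.2)) ≠ .inr b}) (by
            intro h0
            have : boundary g φ (.inr b) = 0 := h0
            simp [this] at hb)
        exact ⟨d, hd.1⟩
      exact ((Set.finite_range _).preimage (Sum.inr_injective.injOn)).subset hsub
    rw [oddBlocks, ← Set.ncard_image_of_injective _ (Option.some_injective V)]
    refine Set.ncard_le_ncard_of_injOn (fun e => (slotBase g e).map rep) ?_ ?_ (hfin.image _)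
    · rintro e ⟨he, heF⟩
      obtain ⟨a, ha⟩ := slotClass_ne_none_iff.1 he
      refine ⟨rep a, ?_, by simp [ha]⟩
      let p : E → Bool := fun f => decide ((slotBase g f).map rep = some (rep a))
      have hb : boundary g φ (.inr (rep a)) = ({f | p f = true} : Set E).ncard := by
        have key : ∀ d : E × Bool, d ∈ {d : E × Bool | ext φ (g d.1 d.2) = .inr (rep a) ∧
            ext φ (g d.1 (!d.2)) ≠ .inr (rep a)} ↔
            ∃ c v, g d.1 d.2 = .inl v ∧ g d.1 (!d.2) = .inr c ∧ rep v = rep a := by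
          rintro ⟨f, i⟩
          simp only [Set.mem_ofPred_eq]
          constructor
          · rintro ⟨h1, h2⟩
            rcases h : g f i with v | c
            · rw [h] at h1
              have h1 : rep v = rep a := by simpa [ext, φ] using h1
              rcases h' : g f (!i) with w | c
              · rw [h'] at h2
                have := hlink f i v w h h'
                exact absurd (by simp [ext, φ, ← this, h1]) h2
              · exact ⟨c, v, rfl, rfl, h1⟩
            · rw [h] at h1; simp [ext] at h1
          · rintro ⟨c, v, h1, h2, h3⟩
            rw [h1, h2]
            simp [ext, φ, h3]
        refine Set.ncard_congr (fun d _ => d.1) ?_ ?_ ?_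
        · intro d hd
          obtain ⟨c, v, h1, h2, h3⟩ := (key d).1 hd
          have : slotBase g d.1 = some v := slotBase_eq_some.2 ⟨_, c, h2, by simpa using h1⟩
          simp [p, this, h3]
        · rintro ⟨f, i⟩ ⟨f', i'⟩ hd hd' heq
          obtain ⟨c, v, h1, h2, -⟩ := (key _).1 hd
          obtain ⟨c', v', h1', h2', -⟩ := (key _).1 hd'
          simp only at heq h1 h2 h1' h2'
          subst heq
          have : i = i' := by
            by_contra hne
            rw [Bool.eq_not_of_ne hne, Bool.not_not, h1'] at h2
            cases h2
          rw [this]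
        · intro f hf
          simp only [p, Set.mem_ofPred_eq, decide_eq_true_eq, Option.map_eq_some_iff] at hf
          obtain ⟨v, hv, hva⟩ := hf
          obtain ⟨i, c, h1, h2⟩ := slotBase_eq_some.1 hv
          exact ⟨(f, !i), (key _).2 ⟨c, v, h2, by simpa using h1, hva⟩, rfl⟩
      have hset : ({f | p f = true} : Set E) =
          ((insert e (F.flatten.filter p).toFinset : Finset E) : Set E) := by
        ext f
        simp only [Set.mem_ofPred_eq, Finset.coe_insert, List.coe_toFinset, Set.mem_insert_iff,
          List.mem_filter]
        constructor
        · intro hf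
          by_cases hfF : f ∈ F.flatten
          · exact Or.inr ⟨hfF, hf⟩
          · left
            simp only [p, decide_eq_true_eq, Option.map_eq_some_iff] at hf
            obtain ⟨v, hv, hva⟩ := hf
            obtain ⟨m, w⟩ := (hrep _ _).1 hva
            exact hFc f e v a m hv ha w hfF heF
        · rintro (rfl | h)
          · simp [p, ha]
          · exact h.2
      have heF' : e ∉ (F.flatten.filter p).toFinset := fun h =>
        heF (List.mem_filter.1 (List.mem_toFinset.1 h)).1
      change Odd _
      rw [hb, hset, Set.ncard_coe_finset, Finset.card_insert_of_notMem heF', List.toFinset_card_of_nodup (hFn.filter _),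
        ← List.countP_eq_length_filter]
      -- Besides `e`, the boundary of the block consists of paired terminal edges, and both ends of
      -- a linkage belong to the same block.
      refine Even.add_one (even_countP_flatten fun l hl => ?_)
      obtain ⟨u, m, v, x, y, rfl, hu, hv, w⟩ := hF.1 l hl
      have hm : m.countP p = 0 := by
        rw [List.countP_eq_zero]
        intro f hf
        simp [p, slotBase_eq_none_of_slotClass (w.slotClass_eq f hf)]
      have huv : p u = p v := by
        simp only [p, hu, hv, Option.map_some, (hrep x y).2 ⟨m, w⟩]
      rw [List.countP_cons, List.countP_append, hm, List.countP_singleton, huv]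
      by_cases hv : p v = true <;> simp [hv]
    · rintro e ⟨he, heF⟩ f ⟨hf, hfF⟩ heq
      obtain ⟨a, ha⟩ := slotClass_ne_none_iff.1 he
      obtain ⟨b, hb⟩ := slotClass_ne_none_iff.1 hf
      simp only [ha, hb, Option.map_some, Option.some.injEq] at heq
      obtain ⟨m, w⟩ := (hrep a b).1 heq
      exact hFc e f a b m ha hb w heF hfF
  omega

end

/-! ### Splitting off a terminal end and contracting a vertex into a class -/

section

variable {V C E : Type*}

theorem Valid.congr {g g' : E → Bool → V ⊕ C} {φ φ' : V → C ⊕ V} (h : Valid g' φ')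
    (hstep : ∀ a b, Step g φ a b ↔ Step g' φ' a b) (hr : ∀ v b, φ v = .inr b → φ' v = .inr b)
    (hp : ∀ v c, φ v = .inl c → ∃ e i, g e i = .inr c) : Valid g φ := by
  refine ⟨fun a b c d hc hd => ?_, hp⟩
  have : Step g φ = Step g' φ' := by
    ext a b; exact hstep a b
  rw [this]
  exact h.connected a b c d (hr _ _ hc) (hr _ _ hd)

theorem oddBlocks_congr {g g' : E → Bool → V ⊕ C} {φ φ' : V → C ⊕ V}
    (h : ∀ e i b, ext φ (g e i) = .inr b ↔ ext φ' (g' e i) = .inr b) :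
    oddBlocks g φ = oddBlocks g' φ' := by
  simp only [oddBlocks, boundary, ne_eq, h]

theorem exists_rel_of_mem {R : E → E → Prop} {a : E} {m : List E} (h : (a :: m).IsChain R) {e : E}
    (he : e ∈ m) : ∃ f, R f e := by
  induction m generalizing a with
  | nil => simp at he
  | cons b m ih =>
    rw [List.isChain_cons_cons] at h
    rcases List.mem_cons.1 he with rfl | he
    · exact ⟨a, h.1⟩
    · exact ih h.2 he

theorem Reg.exists_inner {g : E → Bool → V ⊕ C} {l : List E}
    (h : Reg (EdgeAdj g) (slotClass g) l) {e : E} (he : e ∈ l) : ∃ i v, g e i = .inl v := by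
  obtain ⟨h1, a, b, c, c', ha, hb, hc, hc', hne, hi⟩ := h
  cases l with
  | nil => simp at he
  | cons a' m =>
    obtain rfl : a' = a := by simpa using ha
    rcases List.mem_cons.1 he with rfl | he
    · obtain ⟨i, v, -, h⟩ := slotClass_eq_some.1 hc
      exact ⟨_, v, h⟩
    · obtain ⟨f, v, i, j, -, h⟩ := exists_rel_of_mem h1 he
      exact ⟨j, v, h⟩

open Classical in
/-- Move one end of the edge `e₀` to the class `s'`. -/
noncomputable def splitEnd (g : E → Bool → V ⊕ C) (e₀ : E) (i₀ : Bool) (s' : C) :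
    E → Bool → V ⊕ C :=
  fun e i => if e = e₀ ∧ i = i₀ then .inr s' else g e i

open Classical in
/-- Identify the inner vertex `x` with the class `s`. -/
noncomputable def contract (g : E → Bool → V ⊕ C) (x : V) (s : C) : E → Bool → V ⊕ C :=
  fun e i => if g e i = .inl x then .inr s else g e i

section Split

variable {g : E → Bool → V ⊕ C} {e₀ : E} {i₀ : Bool} {s s' : C} {x : V}

theorem splitEnd_eq_inl (h₀ : g e₀ i₀ = .inr s) {e : E} {i : Bool} {v : V} :
    splitEnd g e₀ i₀ s' e i = .inl v ↔ g e i = .inl v := by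
  unfold splitEnd
  split_ifs with h
  · rw [h.1, h.2, h₀]; simp
  · rfl

theorem edgeAdj_splitEnd (h₀ : g e₀ i₀ = .inr s) {e f : E} :
    EdgeAdj (splitEnd g e₀ i₀ s') e f ↔ EdgeAdj g e f := by
  simp only [EdgeAdj, splitEnd_eq_inl h₀]

theorem links_splitEnd (h₀ : g e₀ i₀ = .inr s) {e : E} {a b : V} :
    Links (splitEnd g e₀ i₀ s') e a b ↔ Links g e a b := by
  simp only [Links, splitEnd_eq_inl h₀]

theorem slotClass_splitEnd_of_ne {e : E} (he : e ≠ e₀) :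
    slotClass (splitEnd g e₀ i₀ s') e = slotClass g e := by
  simp [slotClass, splitEnd, he]

theorem slotClass_splitEnd_self (h₁ : g e₀ (!i₀) = .inl x) :
    slotClass (splitEnd g e₀ i₀ s') e₀ = some s' :=
  slotClass_eq_some.2 ⟨i₀, x, by simp [splitEnd], by simp [splitEnd, h₁]⟩

/-- The only way to lose regularity when `s'` becomes `s` again is to join `e₀` to another edge of
class `s`. Without `e₀`, such a chain starts at class `s` and ends in an edge adjacent to `e₀`,
hence at `x`, the only inner end of `e₀`. -/
theorem reg_or_of_reg_splitEnd (h₀ : g e₀ i₀ = .inr s) (h₁ : g e₀ (!i₀) = .inl x) {l : List E}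
    (hl : l.Nodup) (h : Reg (EdgeAdj (splitEnd g e₀ i₀ s')) (slotClass (splitEnd g e₀ i₀ s')) l) :
    Reg (EdgeAdj g) (slotClass g) l ∨ ∃ m, (e₀ :: m).Perm l ∧
      Semi (EdgeAdj g) (slotClass g) (fun e => ∃ i, g e i = .inl x) (· = s) m := by
  have hcl₀ : slotClass g e₀ = some s := slotClass_eq_some.2 ⟨i₀, x, h₀, h₁⟩
  have hx : ∀ e, EdgeAdj g e₀ e → ∃ i, g e i = .inl x := by
    rintro e ⟨v, i, j, hi, hj⟩
    have hii : i = !i₀ := by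
      apply Bool.eq_not_of_ne
      rintro rfl
      rw [h₀] at hi
      cases hi
    rw [hii, h₁] at hi
    cases hi
    exact ⟨j, hj⟩
  have hadj : EdgeAdj (splitEnd g e₀ i₀ s') = EdgeAdj g := by
    ext e f; exact edgeAdj_splitEnd h₀
  rw [hadj] at h
  have main : ∀ l : List E, l.Nodup → l.IsChain (EdgeAdj g) → ∀ b c', l.head? = some e₀ →
      l.getLast? = some b → slotClass (splitEnd g e₀ i₀ s') b = some c' → s' ≠ c' →
      (∀ e ∈ l, e ≠ e₀ → e ≠ b → slotClass (splitEnd g e₀ i₀ s') e = none) →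
      Reg (EdgeAdj g) (slotClass g) l ∨ ∃ m, (e₀ :: m).Perm l ∧
      Semi (EdgeAdj g) (slotClass g) (fun e => ∃ i, g e i = .inl x) (· = s) m := by
    intro l hl h b c' ha hb hc' hne hi
    have hb₀ : b ≠ e₀ := by
      rintro rfl
      rw [slotClass_splitEnd_self h₁] at hc'
      exact hne (Option.some.inj hc')
    rw [slotClass_splitEnd_of_ne hb₀] at hc'
    have hi' : ∀ e ∈ l, e ≠ e₀ → e ≠ b → slotClass g e = none := fun e he h1 h2 => by
      rw [← slotClass_splitEnd_of_ne h1]; exact hi e he h1 h2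
    by_cases hs : s = c'
    · right
      subst hs
      cases l with
      | nil => simp at ha
      | cons a m =>
        obtain rfl : a = e₀ := by simpa using ha
        refine ⟨m.reverse, (List.reverse_perm m).cons _, ?_⟩
        have hm : m ≠ [] := by
          rintro rfl
          exact hb₀ (by simpa using hb.symm)
        obtain ⟨y, m, rfl⟩ := List.exists_cons_of_ne_nil hm
        rw [List.isChain_cons_cons] at h
        refine ⟨List.isChain_reverse.2 (h.2.imp fun _ _ h => h.symm), b, y, s, ?_, by simp, hc', rfl,
          hx y h.1, ?_⟩
        · rw [List.head?_reverse]
          simpa [List.getLast?_cons] using hb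
        · intro e he heb
          have he' : e ∈ y :: m := List.mem_reverse.1 he
          refine hi' e (List.mem_cons_of_mem _ he') ?_ heb
          rintro rfl
          exact (List.nodup_cons.1 hl).1 he'
    · exact Or.inl ⟨h, e₀, b, s, c', ha, hb, hcl₀, hc', hs, hi'⟩
  obtain ⟨h1, a, b, c, c', ha, hb, hc, hc', hne, hi⟩ := h
  by_cases hae : a = e₀
  · subst hae
    rw [slotClass_splitEnd_self h₁] at hc
    cases hc
    exact main l hl h1 b c' ha hb hc' hne hi
  by_cases hbe : b = e₀
  · subst hbe
    rw [slotClass_splitEnd_self h₁] at hc'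
    cases hc'
    rcases main l.reverse (List.nodup_reverse.2 hl)
      (List.isChain_reverse.2 (h1.imp fun _ _ h => h.symm)) a c (by simpa using hb)
      (by simpa using ha) hc hne.symm (fun e he k1 k2 => hi e (by simpa using he) k2 k1) with h | h
    · left; simpa using h.reverse fun _ _ h => h.symm
    · obtain ⟨m, hm, hsem⟩ := h
      exact Or.inr ⟨m, hm.trans (List.reverse_perm l), hsem⟩
  · left
    rw [slotClass_splitEnd_of_ne hae] at hc
    rw [slotClass_splitEnd_of_ne hbe] at hc'
    refine ⟨h1, a, b, c, c', ha, hb, hc, hc', hne, fun e he h2 h3 => ?_⟩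
    have := hi e he h2 h3
    have hee : e ≠ e₀ := by
      rintro rfl
      rw [slotClass_splitEnd_self h₁] at this
      cases this
    rwa [slotClass_splitEnd_of_ne hee] at this

open Classical in
/-- Identify the class `s'` with `s`. -/
noncomputable def mergeClass (s s' : C) (φ : V → C ⊕ V) : V → C ⊕ V :=
  fun v => Sum.map (fun c => if c = s' then s else c) id (φ v)

theorem ext_mergeClass (h₀ : g e₀ i₀ = .inr s) (hs' : ∀ e i, g e i ≠ .inr s') (φ : V → C ⊕ V)
    (e : E) (i : Bool) : ext (mergeClass s s' φ) (g e i) =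
      Sum.map (fun c => open Classical in if c = s' then s else c) id
        (ext φ (splitEnd g e₀ i₀ s' e i)) := by
  unfold splitEnd
  split_ifs with h
  · rw [h.1, h.2, h₀]; simp [ext]
  · rcases h' : g e i with v | c
    · simp [ext, mergeClass]
    · have : c ≠ s' := by
        rintro rfl; exact hs' e i h'
      simp [ext, this]

theorem valid_mergeClass (h₀ : g e₀ i₀ = .inr s) {φ : V → C ⊕ V}
    (h : Valid (splitEnd g e₀ i₀ s') φ) : Valid g (mergeClass s s' φ) := by
  refine h.congr ?_ ?_ ?_
  · intro a b
    simp [Step, links_splitEnd h₀, mergeClass]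
  · intro v b hb
    rcases hv : φ v with c | d
    · simp [mergeClass, hv] at hb
    · simpa [mergeClass, hv] using hb
  · intro v c hc
    rcases hv : φ v with d | d
    · by_cases hd : d = s'
      · simp [mergeClass, hv, hd] at hc
        exact ⟨e₀, i₀, by rw [h₀, hc]⟩
      · simp [mergeClass, hv, hd] at hc
        obtain ⟨e, i, hei⟩ := h.present v d hv
        unfold splitEnd at hei
        split_ifs at hei with hh
        · exact absurd (Sum.inr.inj hei).symm hd
        · exact ⟨e, i, by rw [hei, hc]⟩
    · simp [mergeClass, hv] at hc

/-- Merging two classes can only turn leaving ends into non-leaving ones. -/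
theorem weight_mergeClass [Finite E] (h₀ : g e₀ i₀ = .inr s) (hs' : ∀ e i, g e i ≠ .inr s')
    (φ : V → C ⊕ V) : weight g (mergeClass s s' φ) ≤ weight (splitEnd g e₀ i₀ s') φ := by
  refine Set.ncard_le_ncard ?_ (Set.toFinite _)
  rintro ⟨e, i⟩ ⟨⟨j, v, h1⟩, h2, h3⟩
  refine ⟨⟨j, v, (splitEnd_eq_inl h₀).2 h1⟩, ?_, ?_⟩
  · rw [ext_mergeClass h₀ hs'] at h2
    simpa using h2
  · rw [ext_mergeClass h₀ hs', ext_mergeClass h₀ hs'] at h3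
    intro h
    exact h3 (congrArg _ h)

theorem oddBlocks_mergeClass (h₀ : g e₀ i₀ = .inr s) (hs' : ∀ e i, g e i ≠ .inr s')
    (φ : V → C ⊕ V) : oddBlocks g (mergeClass s s' φ) = oddBlocks (splitEnd g e₀ i₀ s') φ := by
  refine oddBlocks_congr fun e i b => ?_
  rw [ext_mergeClass h₀ hs']
  cases ext φ (splitEnd g e₀ i₀ s' e i) <;> simp

end Split

section Contract

variable {g : E → Bool → V ⊕ C} {s : C} {x : V}

theorem contract_eq_inl {e : E} {i : Bool} {v : V} :
    contract g x s e i = .inl v ↔ g e i = .inl v ∧ v ≠ x := by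
  unfold contract
  split_ifs with h
  · simp [h]; tauto
  · constructor
    · intro h'
      refine ⟨h', ?_⟩
      rintro rfl
      exact h h'
    · exact And.left

theorem contract_eq_inr {e : E} {i : Bool} {c : C} :
    contract g x s e i = .inr c ↔ g e i = .inr c ∨ g e i = .inl x ∧ c = s := by
  unfold contract
  split_ifs with h
  · simp [h, eq_comm]
  · simp [h]

/-- An end of class `s` in the contraction may come from an inner edge at `x`; the chain then ends
in `X` instead. This cannot happen at both ends, since their classes differ, and the surviving class
is not `s`. -/
theorem Reg.of_contract {l : List E}
    (h : Reg (EdgeAdj (contract g x s)) (slotClass (contract g x s)) l) :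
    ∃ l' : List E, l'.Perm l ∧ (Reg (EdgeAdj g) (slotClass g) l' ∨
      Semi (EdgeAdj g) (slotClass g) (fun e => ∃ i, g e i = .inl x) (· ≠ s) l') := by
  have hin := fun e he => h.exists_inner (e := e) he
  obtain ⟨h1, a, b, c, c', ha, hb, hc, hc', hne, hi⟩ := h
  have h1' : l.IsChain (EdgeAdj g) := h1.imp fun e f ⟨v, i, j, h1, h2⟩ =>
    ⟨v, i, j, (contract_eq_inl.1 h1).1, (contract_eq_inl.1 h2).1⟩
  -- An edge that loses its class under contraction joins `x` to a class and keeps no inner end, so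
  -- it cannot lie on a regular chain of the contraction.
  have hnone : ∀ e ∈ l, slotClass (contract g x s) e = none → slotClass g e = none := by
    intro e he hn
    by_contra hne
    obtain ⟨t, ht⟩ := Option.ne_none_iff_exists'.1 hne
    obtain ⟨i, v, hi, hv⟩ := slotClass_eq_some.1 ht
    have hvx : v = x := by
      by_contra hvx
      have := (slotClass_eq_some (g := contract g x s)).2 ⟨i, v, contract_eq_inr.2 (Or.inl hi), contract_eq_inl.2 ⟨hv, hvx⟩⟩
      rw [hn] at this
      cases this
    obtain ⟨j, w, hj⟩ := hin e he
    obtain ⟨hj, hw⟩ := contract_eq_inl.1 hj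
    by_cases hij : j = i
    · rw [hij, hi] at hj; cases hj
    · rw [Bool.eq_not_of_ne hij, hv] at hj
      cases hj
      exact hw hvx
  have hend : ∀ e c, slotClass (contract g x s) e = some c → slotClass g e = some c ∨
      c = s ∧ slotClass g e = none ∧ ∃ i, g e i = .inl x := by
    intro e c hc
    obtain ⟨i, v, hi, hv⟩ := slotClass_eq_some.1 hc
    have hv := (contract_eq_inl.1 hv).1
    rcases contract_eq_inr.1 hi with h | ⟨h, hcs⟩
    · exact Or.inl (slotClass_eq_some.2 ⟨i, v, h, hv⟩)
    · exact Or.inr ⟨hcs, Links.slotClass_eq (a := x) (b := v) ⟨i, h, hv⟩, i, h⟩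
  rcases hend a c hc with hca | ⟨rfl, hna, hxa⟩
  · rcases hend b c' hc' with hcb | ⟨rfl, hnb, hxb⟩
    · exact ⟨l, .refl _, Or.inl ⟨h1', a, b, c, c', ha, hb, hca, hcb, hne, fun e he k1 k2 =>
        hnone e he (hi e he k1 k2)⟩⟩
    · refine ⟨l, .refl _, Or.inr ⟨h1', a, b, c, ha, hb, hca, hne, hxb, fun e he k1 => ?_⟩⟩
      by_cases heb : e = b
      · rw [heb]; exact hnb
      · exact hnone e he (hi e he k1 heb)
  · rcases hend b c' hc' with hcb | ⟨rfl, hnb, hxb⟩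
    · refine ⟨l.reverse, l.reverse_perm, Or.inr ⟨List.isChain_reverse.2 (h1'.imp fun _ _ h => h.symm),
        b, a, c', by simpa using hb, by simpa using ha, hcb, hne.symm, hxa, fun e he k1 => ?_⟩⟩
      have he := List.mem_reverse.1 he
      by_cases hea : e = a
      · rw [hea]; exact hna
      · exact hnone e he (hi e he hea k1)
    · exact absurd rfl hne

open Classical in
/-- Assign the vertex `x` to the class `s`. -/
noncomputable def assign (x : V) (s : C) (φ : V → C ⊕ V) : V → C ⊕ V :=
  fun v => if v = x then .inl s else φ v

theorem ext_assign (φ : V → C ⊕ V) (e : E) (i : Bool) :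
    ext (assign x s φ) (g e i) = ext φ (contract g x s e i) := by
  unfold contract
  split_ifs with h
  · rw [h]; simp [ext, assign]
  · rcases h' : g e i with v | c
    · have : v ≠ x := by rintro rfl; exact h h'
      simp [ext, assign, this]
    · simp [ext]

theorem valid_assign (hs : ∃ e i, g e i = .inr s) {φ : V → C ⊕ V}
    (h : Valid (contract g x s) φ) : Valid g (assign x s φ) := by
  refine h.congr ?_ ?_ ?_
  · intro a b
    by_cases ha : a = x
    · simp [Step, assign, Links, contract_eq_inl, ha]
    by_cases hb : b = x
    · simp [Step, assign, Links, contract_eq_inl, hb]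
    simp [Step, assign, Links, contract_eq_inl, ha, hb]
  · intro v b hb
    unfold assign at hb
    split_ifs at hb
    exact hb
  · intro v c hc
    unfold assign at hc
    split_ifs at hc
    · cases hc; exact hs
    · obtain ⟨e, i, hei⟩ := h.present v c hc
      rcases contract_eq_inr.1 hei with h | ⟨-, rfl⟩
      · exact ⟨e, i, h⟩
      · exact hs

/-- The edges from `x` to classes other than `s` have no inner end after contraction and drop out of
the weight there. In `g` each of them may contribute two ends; `exists_family_of_contract` gains one
chain from each in return. -/
theorem weight_assign [Finite E] (φ : V → C ⊕ V) : weight g (assign x s φ) ≤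
    weight (contract g x s) φ +
      2 * ({e | ∃ i c, g e i = .inl x ∧ g e (!i) = .inr c ∧ c ≠ s} : Set E).ncard := by
  set D : Set E := {e | ∃ i c, g e i = .inl x ∧ g e (!i) = .inr c ∧ c ≠ s}
  have hD : (D ×ˢ (Set.univ : Set Bool)).ncard = 2 * D.ncard := by
    rw [Set.ncard_prod, Set.ncard_univ, Nat.card_eq_fintype_card, Fintype.card_bool, mul_comm]
  rw [← hD]
  refine (Set.ncard_le_ncard ?_ (Set.toFinite _)).trans (Set.ncard_union_le _ _)
  rintro ⟨e, i⟩ ⟨⟨j, v, h1⟩, h2, h3⟩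
  rw [ext_assign, ext_assign] at h3
  rw [ext_assign] at h2
  by_cases hin : ∃ i v, contract g x s e i = .inl v
  · exact Or.inl ⟨hin, h2, h3⟩
  · right
    have hv : v = x := by
      by_contra hv
      exact hin ⟨j, v, contract_eq_inl.2 ⟨h1, hv⟩⟩
    subst hv
    refine ⟨?_, Set.mem_univ _⟩
    simp only at h1 h3
    have hj : contract g v s e j = .inr s := contract_eq_inr.2 (Or.inr ⟨h1, rfl⟩)
    rcases h4 : g e (!j) with w | c
    · exfalso
      have hw : w = v := by
        by_contra hw
        exact hin ⟨!j, w, contract_eq_inl.2 ⟨h4, hw⟩⟩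
      rw [hw] at h4
      have hj' : contract g v s e (!j) = .inr s := contract_eq_inr.2 (Or.inr ⟨h4, rfl⟩)
      apply h3
      by_cases hij : i = j
      · rw [hij, hj, hj']
      · rw [Bool.eq_not_of_ne hij, Bool.not_not, hj, hj']
    · refine ⟨j, c, h1, h4, ?_⟩
      rintro rfl
      have hj' : contract g v c e (!j) = .inr c := contract_eq_inr.2 (Or.inl h4)
      apply h3
      by_cases hij : i = j
      · rw [hij, hj, hj']
      · rw [Bool.eq_not_of_ne hij, Bool.not_not, hj, hj']

theorem oddBlocks_assign (φ : V → C ⊕ V) :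
    oddBlocks g (assign x s φ) = oddBlocks (contract g x s) φ :=
  oddBlocks_congr fun e i b => by rw [ext_assign]

/-- Chains in the contracted network, and the edges joining `x` to classes other than `s`. -/
theorem exists_family_of_contract [Finite E] {Q : List (List E)}
    (hQ : ∀ q ∈ Q, Reg (EdgeAdj (contract g x s)) (slotClass (contract g x s)) q)
    (hQn : Q.flatten.Nodup) :
    ∃ Q' : List (List E), Q'.length = Q.length +
      ({e | ∃ i c, g e i = .inl x ∧ g e (!i) = .inr c ∧ c ≠ s} : Set E).ncard ∧
      Q'.flatten.Nodup ∧ ∀ q ∈ Q', Reg (EdgeAdj g) (slotClass g) q ∨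
        Semi (EdgeAdj g) (slotClass g) (fun e => ∃ i, g e i = .inl x) (· ≠ s) q := by
  set D : Set E := {e | ∃ i c, g e i = .inl x ∧ g e (!i) = .inr c ∧ c ≠ s} with hDdef
  have h1 : ∃ Q' : List (List E), Q'.length = Q.length ∧ Q'.flatten.Perm Q.flatten ∧
      ∀ q ∈ Q', Reg (EdgeAdj g) (slotClass g) q ∨
        Semi (EdgeAdj g) (slotClass g) (fun e => ∃ i, g e i = .inl x) (· ≠ s) q := by
    clear hQn
    induction Q with
    | nil => exact ⟨[], rfl, .refl _, by simp⟩
    | cons q Q ih =>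
      obtain ⟨Q', h1, h2, h3⟩ := ih fun q hq => hQ q (List.mem_cons_of_mem _ hq)
      obtain ⟨q', h4, h5⟩ := (hQ q (by simp)).of_contract
      refine ⟨q' :: Q', by simp [h1], by simpa using h4.append h2, ?_⟩
      intro y hy
      rcases List.mem_cons.1 hy with rfl | hy
      · exact h5
      · exact h3 y hy
  obtain ⟨Q', hl, hp, hQ'⟩ := h1
  have hDf : D.Finite := Set.toFinite _
  refine ⟨Q' ++ hDf.toFinset.toList.map fun e => [e], ?_, ?_, ?_⟩
  · simp [hl, Set.ncard_eq_toFinset_card D hDf]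
  · have hflat : (hDf.toFinset.toList.map fun e => [e]).flatten = hDf.toFinset.toList := by
      rw [← List.flatMap_def]
      exact List.flatMap_singleton' _
    rw [List.flatten_append, hflat, List.nodup_append']
    refine ⟨hp.nodup_iff.2 hQn, Finset.nodup_toList _, fun e he he' => ?_⟩
    obtain ⟨q, hq, heq⟩ := List.mem_flatten.1 (hp.mem_iff.1 he)
    obtain ⟨j, v, hj⟩ := (hQ q hq).exists_inner heq
    obtain ⟨hj, hv⟩ := contract_eq_inl.1 hj
    obtain ⟨i, c, hi, hi', -⟩ : e ∈ D := by simpa using he'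
    by_cases hij : j = i
    · rw [hij, hi] at hj; cases hj; exact hv rfl
    · rw [Bool.eq_not_of_ne hij, hi'] at hj; cases hj
  · intro q hq
    rcases List.mem_append.1 hq with hq | hq
    · exact hQ' q hq
    · obtain ⟨e, he, rfl⟩ := List.mem_map.1 hq
      obtain ⟨i, c, hi, hi', hc⟩ : e ∈ D := by simpa using he
      right
      refine ⟨by simp, e, e, c, rfl, rfl, ?_, hc, ⟨i, hi⟩, by simp⟩
      exact slotClass_eq_some.2 ⟨!i, x, hi', by simpa using hi⟩

end Contract

end

/-! ### The induction on the network -/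

section

variable {V C E : Type*}

/-- The edge ends at inner vertices. -/
def innerEnds (g : E → Bool → V ⊕ C) : Set (E × Bool) := {d | ∃ v, g d.1 d.2 = .inl v}

/-- The pairs of distinct edges of the same class. -/
def classPairs (g : E → Bool → V ⊕ C) : Set (E × E) :=
  {d | d.1 ≠ d.2 ∧ ∃ c, slotClass g d.1 = some c ∧ slotClass g d.2 = some c}

theorem innerEnds_splitEnd {g : E → Bool → V ⊕ C} {e₀ : E} {i₀ : Bool} {s s' : C}
    (h₀ : g e₀ i₀ = .inr s) : innerEnds (splitEnd g e₀ i₀ s') = innerEnds g := by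
  ext d
  simp only [innerEnds, Set.mem_ofPred_eq, splitEnd_eq_inl h₀]

theorem ncard_innerEnds_contract [Finite E] {g : E → Bool → V ⊕ C} {e₀ : E} {i₀ : Bool} {x : V}
    {s : C} (h₁ : g e₀ i₀ = .inl x) :
    (innerEnds (contract g x s)).ncard < (innerEnds g).ncard := by
  refine Set.ncard_lt_ncard ⟨?_, ?_⟩ (Set.toFinite _)
  · rintro d ⟨v, hv⟩
    exact ⟨v, (contract_eq_inl.1 hv).1⟩
  · intro h
    obtain ⟨v, hv⟩ := h (show (e₀, i₀) ∈ innerEnds g from ⟨x, h₁⟩)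
    obtain ⟨h2, h3⟩ := contract_eq_inl.1 hv
    simp only [h₁, Sum.inl.injEq] at h2
    exact h3 h2.symm

theorem ncard_classPairs_splitEnd [Finite E] {g : E → Bool → V ⊕ C} {e₀ f₀ : E} {i₀ : Bool} {x : V}
    {s s' : C} (h₀ : g e₀ i₀ = .inr s) (h₁ : g e₀ (!i₀) = .inl x) (hs' : ∀ e i, g e i ≠ .inr s')
    (hne : e₀ ≠ f₀) (hf : slotClass g f₀ = some s) :
    (classPairs (splitEnd g e₀ i₀ s')).ncard < (classPairs g).ncard := by
  have hfresh : ∀ f, f ≠ e₀ → slotClass (splitEnd g e₀ i₀ s') f ≠ some s' := by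
    intro f hf h
    rw [slotClass_splitEnd_of_ne hf] at h
    obtain ⟨i, v, h, -⟩ := slotClass_eq_some.1 h
    exact hs' f i h
  have hself : slotClass (splitEnd g e₀ i₀ s') e₀ = some s' := slotClass_splitEnd_self h₁
  refine Set.ncard_lt_ncard ⟨?_, ?_⟩ (Set.toFinite _)
  · rintro ⟨e, f⟩ ⟨hef, c, he, hf⟩
    simp only at hef he hf
    have h1 : e ≠ e₀ := by
      rintro rfl
      rw [hself] at he
      cases he
      exact hfresh f hef.symm hf
    have h2 : f ≠ e₀ := by
      rintro rfl
      rw [hself] at hf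
      cases hf
      exact hfresh e hef he
    rw [slotClass_splitEnd_of_ne h1] at he
    rw [slotClass_splitEnd_of_ne h2] at hf
    exact ⟨hef, c, he, hf⟩
  · intro h
    obtain ⟨-, c, h2, h3⟩ := h (show (e₀, f₀) ∈ classPairs g from
      ⟨hne, s, slotClass_eq_some.2 ⟨i₀, x, h₀, h₁⟩, hf⟩)
    simp only at h2 h3
    rw [hself] at h2
    cases h2
    exact hfresh f₀ hne.symm h3

/-- The split dual certifies `P.length` and the contracted dual certifies `Q.length`. Which one is
tight in `g` depends on the comparison of these two numbers. -/
theorem hasMinMax_of_split_of_contract [Finite E] {g : E → Bool → V ⊕ C} {e₀ : E} {i₀ : Bool}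
    {x : V} {s s' : C} (h₀ : g e₀ i₀ = .inr s) (h₁ : g e₀ (!i₀) = .inl x)
    (hs' : ∀ e i, g e i ≠ .inr s') (hsplit : HasMinMax (splitEnd g e₀ i₀ s'))
    (hcon : HasMinMax (contract g x s)) : HasMinMax g := by
  obtain ⟨P, φ₁, hP, hPn, hv₁, hw₁⟩ := hsplit
  have hφ₁ : weight g (mergeClass s s' φ₁) ≤
      2 * P.length + oddBlocks g (mergeClass s s' φ₁) := by
    have := weight_mergeClass h₀ hs' φ₁
    rw [oddBlocks_mergeClass h₀ hs' φ₁]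
    omega
  have hPnd := (List.nodup_flatten.1 hPn).1
  by_cases hall : ∀ l ∈ P, Reg (EdgeAdj g) (slotClass g) l
  · exact ⟨P, _, hall, hPn, valid_mergeClass h₀ hv₁, hφ₁⟩
  push Not at hall
  obtain ⟨l, hl, hln⟩ := hall
  obtain ⟨m, hm, hsem⟩ := (reg_or_of_reg_splitEnd h₀ h₁ (hPnd l hl) (hP l hl)).resolve_left hln
  -- The bad chain is replaced by the two chains `[e₀]` and `m` from `s` to `x`. Each carries one
  -- class, so the number of slots remains `2 * P.length`.
  obtain ⟨P₀, hP₀⟩ := exists_cons_perm_of_mem hl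
  have hflat : ([e₀] :: m :: P₀).flatten.Perm P.flatten := by
    refine List.Perm.trans ?_ hP₀.flatten
    simpa using hm.append_right P₀.flatten
  have hPn' := hflat.nodup_iff.2 hPn
  have hreg₀ : ∀ p ∈ P₀, Reg (EdgeAdj g) (slotClass g) p := by
    intro p hp
    have hpP : p ∈ P := hP₀.mem_iff.1 (List.mem_cons_of_mem _ hp)
    refine (reg_or_of_reg_splitEnd h₀ h₁ (hPnd p hpP) (hP p hpP)).resolve_right ?_
    rintro ⟨m', hm', -⟩
    have : e₀ ∈ p := hm'.mem_iff.1 (by simp)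
    simp only [List.flatten_cons, List.singleton_append, List.nodup_cons, List.mem_append] at hPn'
    exact hPn'.1 (Or.inr (List.mem_flatten.2 ⟨p, hp, this⟩))
  have hlen : P.length = P₀.length + 1 := by simpa using hP₀.length_eq.symm
  have hleg : Semi (EdgeAdj g) (slotClass g) (fun e => ∃ i, g e i = .inl x) (· = s) [e₀] :=
    ⟨by simp, e₀, e₀, s, rfl, rfl, slotClass_eq_some.2 ⟨i₀, x, h₀, h₁⟩, rfl, ⟨_, h₁⟩, by simp⟩
  obtain ⟨Q₀, φ₂, hQ₀, hQ₀n, hv₂, hw₂⟩ := hcon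
  obtain ⟨Q, hQlen, hQn, hQ⟩ := exists_family_of_contract hQ₀ hQ₀n
  by_cases hle : P.length ≤ Q.length
  · have htake : (Q.take P.length).length = P.length := by simp [hle]
    have hfam : ∀ p ∈ [e₀] :: m :: P₀, Reg (EdgeAdj g) (slotClass g) p ∨
        Semi (EdgeAdj g) (slotClass g) (fun e => ∃ i, g e i = .inl x) (· = s) p := by
      intro p hp
      rcases List.mem_cons.1 hp with rfl | hp
      · exact Or.inr hleg
      rcases List.mem_cons.1 hp with rfl | hp
      · exact Or.inr hsem
      · exact Or.inl (hreg₀ p hp)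
    have hn := (List.nodup_flatten.1 hPn').1
    have hcount : 2 * (Q.take P.length).length ≤
        (([e₀] :: m :: P₀).map (slotCount (slotClass g))).sum := by
      have h2 : (P₀.map (slotCount (slotClass g))).sum = 2 * P₀.length := by
        have hmap : P₀.map (slotCount (slotClass g)) = P₀.map fun _ => 2 :=
          List.map_congr_left fun p hp => (hreg₀ p hp).slotCount (hn p (by simp [hp]))
        rw [hmap]
        simp [mul_comm]
      rw [List.map_cons, List.map_cons, List.sum_cons, List.sum_cons, h2,
        hleg.slotCount (hn _ (by simp)), hsem.slotCount (hn _ (by simp)), htake, hlen]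
      omega
    obtain ⟨L, hL1, hL2, hL3⟩ := exists_all_reg (fun _ _ h => EdgeAdj.symm h)
      (fun e f ⟨i, hi⟩ ⟨j, hj⟩ _ => ⟨x, i, j, hi, hj⟩) hfam hPn'
      (fun q hq => hQ q (List.mem_of_mem_take hq))
      (hQn.sublist (List.Sublist.flatten (List.take_sublist _ _))) hcount
    exact ⟨L, _, hL2, hL3, valid_mergeClass h₀ hv₁, by rw [hL1, htake]; exact hφ₁⟩
  -- Here `Q.length ≤ P₀.length`: dropping the bad chain loses one path, which the contracted dual
  -- allows.
  · refine ⟨P₀, _, hreg₀, ?_, valid_assign ⟨e₀, i₀, h₀⟩ hv₂, ?_⟩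
    · have h := (hP₀.flatten.nodup_iff.2 hPn)
      rw [List.flatten_cons, List.nodup_append'] at h
      exact h.2.1
    · have := weight_assign (g := g) (x := x) (s := s) φ₂
      rw [oddBlocks_assign]
      omega

/-- Contraction removes the inner ends at `x`. Splitting keeps the inner ends but separates `e` from
`f`, so the number of equal-class pairs drops. -/
theorem hasMinMax [Finite E] [Infinite C] (g : E → Bool → V ⊕ C) : HasMinMax g := by
  generalize hm : (innerEnds g).ncard = m
  induction m using Nat.strong_induction_on generalizing g with
  | _ m ihm =>
  generalize hn : (classPairs g).ncard = n
  induction n using Nat.strong_induction_on generalizing g with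
  | _ n ihn =>
  by_cases hinj : ∀ e f c, slotClass g e = some c → slotClass g f = some c → e = f
  · exact hasMinMax_of_injective hinj
  push Not at hinj
  obtain ⟨e, f, s, he, hf, hef⟩ := hinj
  obtain ⟨i, x, h₀, h₁⟩ := slotClass_eq_some.1 he
  -- Only finitely many classes occur in `g`, so the infinite type `C` supplies a fresh one.
  obtain ⟨s', hs'⟩ := ((Set.finite_range fun d : E × Bool => g d.1 d.2).preimage
    (Sum.inr_injective.injOn)).exists_notMem
  have hs' : ∀ e i, g e i ≠ .inr s' := fun e i h => hs' ⟨(e, i), h⟩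
  refine hasMinMax_of_split_of_contract h₀ h₁ hs' ?_ ?_
  · refine ihn _ ?_ _ ?_ rfl
    · rw [← hn]; exact ncard_classPairs_splitEnd h₀ h₁ hs' hef hf
    · rw [innerEnds_splitEnd h₀, hm]
  · refine ihm _ ?_ _ rfl
    rw [← hm]; exact ncard_innerEnds_contract h₁

end

end Routing

/-! ### Walks, cuts and the easy inequality -/

namespace Graph

section

variable {α β : Type*} {G : Graph α β}

theorem mem_cutEdges_iff {e : β} {x y : α} (h : G.IsLink e x y) (K : Set α) :
    e ∈ G.cutEdges K ↔ (x ∈ K ∧ y ∉ K ∨ y ∈ K ∧ x ∉ K) := by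
  constructor
  · rintro ⟨a, ha, b, hb, hab⟩
    rcases h.eq_and_eq_or_eq_and_eq hab with ⟨rfl, rfl⟩ | ⟨rfl, rfl⟩
    · exact Or.inl ⟨ha, hb.2⟩
    · exact Or.inr ⟨ha, hb.2⟩
  · rintro (⟨hx, hy⟩ | ⟨hy, hx⟩)
    · exact ⟨x, hx, y, ⟨h.right_mem, hy⟩, h⟩
    · exact ⟨y, hy, x, ⟨h.left_mem, hx⟩, h.symm⟩

theorem cutEdges_subset (K : Set α) : G.cutEdges K ⊆ G.edgeSet := by
  rintro e ⟨x, -, y, -, h⟩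
  exact h.edge_mem

theorem Walk.right_mem {x y : α} (w : G.Walk x y) : y ∈ G.vertexSet := by
  induction w with
  | nil x hx => exact hx
  | cons e h w ih => exact ih

theorem Walk.left_mem {x y : α} (w : G.Walk x y) : x ∈ G.vertexSet := by
  cases w with
  | nil _ hx => exact hx
  | cons e h w => exact h.left_mem

theorem Walk.left_mem_support {x y : α} (w : G.Walk x y) : x ∈ w.support := by
  cases w <;> simp [Walk.support]

theorem Walk.mem_support_of_mem_edges {x y : α} (w : G.Walk x y) {e : β} (he : e ∈ w.edges)
    {a b : α} (h : G.IsLink e a b) : a ∈ w.support := by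
  induction w with
  | nil x hx => simp [Walk.edges] at he
  | cons f hf w ih =>
    simp only [Walk.edges, List.mem_cons, Walk.support] at he ⊢
    rcases he with rfl | he
    · rcases h.left_eq_or_eq hf with rfl | rfl
      · exact Or.inl rfl
      · exact Or.inr w.left_mem_support
    · exact Or.inr (ih he)

theorem Walk.IsPath.nodup_edges {x y : α} {w : G.Walk x y} (hw : w.IsPath) : w.edges.Nodup := by
  induction w with
  | nil x hx => simp [Walk.edges]
  | cons e h w ih =>
    simp only [Walk.IsPath, Walk.support, Walk.edges, List.nodup_cons] at hw ⊢
    exact ⟨fun he => hw.1 (w.mem_support_of_mem_edges he h), ih hw.2⟩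

theorem Walk.exists_mem_cutEdges {x y : α} (w : G.Walk x y) {K : Set α} (hx : x ∈ K)
    (hy : y ∉ K) : ∃ e ∈ w.edges, e ∈ G.cutEdges K := by
  induction w with
  | nil x _ => exact absurd hx hy
  | @cons x z y e h w ih =>
    by_cases hz : z ∈ K
    · obtain ⟨f, hf, hf'⟩ := ih hz hy
      exact ⟨f, List.mem_cons_of_mem _ hf, hf'⟩
    · exact ⟨e, List.mem_cons_self, (mem_cutEdges_iff h K).2 (Or.inl ⟨hx, hz⟩)⟩

open Classical in
theorem Walk.odd_countP_cutEdges {x y : α} (w : G.Walk x y) (K : Set α) :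
    Odd (w.edges.countP fun e => decide (e ∈ G.cutEdges K)) ↔ ¬ (x ∈ K ↔ y ∈ K) := by
  induction w with
  | nil x hx => simp [Walk.edges]
  | @cons x z y e h w ih =>
    have hc := mem_cutEdges_iff h K
    rw [Walk.edges, List.countP_cons]
    by_cases he : e ∈ G.cutEdges K
    · simp only [he, decide_true, if_true, Nat.odd_add_one, ih]
      tauto
    · simp only [he, decide_false, Bool.false_eq_true, if_false, Nat.add_zero, ih]
      tauto

def Walk.append {x y z : α} : G.Walk x y → G.Walk y z → G.Walk x z
  | .nil _ _, w => w
  | .cons e h w', w => .cons e h (w'.append w)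

def Walk.reverse {x y : α} : G.Walk x y → G.Walk y x
  | .nil x hx => .nil x hx
  | .cons e h w => w.reverse.append (.cons e h.symm (.nil _ h.left_mem))

theorem IsComponentSet.subset_vertexSet {H : Graph α β} {K : Set α} (hK : H.IsComponentSet K) :
    K ⊆ H.vertexSet := by
  obtain ⟨x, hx, rfl⟩ := hK
  rintro y ⟨w⟩
  exact w.right_mem

theorem IsComponentSet.eq_of_mem {H : Graph α β} {K : Set α} (hK : H.IsComponentSet K) {a : α}
    (ha : a ∈ K) : K = {y | Nonempty (H.Walk a y)} := by
  obtain ⟨x, hx, rfl⟩ := hK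
  obtain ⟨w⟩ := ha
  ext y
  exact ⟨fun ⟨w'⟩ => ⟨w.reverse.append w'⟩, fun ⟨w'⟩ => ⟨w.append w'⟩⟩

theorem IsComponentSet.mem_of_isLink {H : Graph α β} {K : Set α} (hK : H.IsComponentSet K)
    {a b : α} {e : β} (ha : a ∈ K) (h : H.IsLink e a b) : b ∈ K := by
  rw [hK.eq_of_mem ha]
  exact ⟨.cons e h (.nil _ h.right_mem)⟩

/-- Paths and odd components are charged to pairs of a set `X s` and an edge of its boundary: two
pairs per path, one per odd component, all distinct. -/
theorem HasEdgeDisjointTPaths.two_mul_add_le (hE : G.edgeSet.Finite) {T : Finset α}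
    {X : T → Set α} (hX : G.IsTSubpartition T X) {k : ℕ} (hk : G.HasEdgeDisjointTPaths T k) :
    2 * k + G.oddComponents T X ≤ ∑ s : T, G.cutSize (X s) := by
  classical
  obtain ⟨P, hP⟩ := hk
  have hmemX : ∀ s : T, (s : α) ∈ X s := fun s => by
    have : (s : α) ∈ X s ∩ (T : Set α) := by rw [hX.inter_eq]; rfl
    exact this.1
  have hnotX : ∀ s : T, ∀ t ∈ T, t ≠ s → t ∉ X s := fun s t ht hne hts => by
    have : t ∈ X s ∩ (T : Set α) := ⟨hts, ht⟩
    rw [hX.inter_eq] at this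
    exact hne this
  have hsrc : ∀ i, ∃ e ∈ (P i).walk.edges, e ∈ G.cutEdges (X ⟨(P i).source, (P i).source_mem⟩) :=
    fun i => (P i).walk.exists_mem_cutEdges (hmemX ⟨_, (P i).source_mem⟩)
      (hnotX ⟨_, (P i).source_mem⟩ _ (P i).target_mem (P i).source_ne_target.symm)
  have htgt : ∀ i, ∃ e ∈ (P i).walk.edges, e ∈ G.cutEdges (X ⟨(P i).target, (P i).target_mem⟩) := by
    intro i
    obtain ⟨e, he, b, hb⟩ : ∃ e, e ∈ (P i).walk.edges ∧ e ∈ G.cutEdges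
        (X ⟨(P i).target, (P i).target_mem⟩)ᶜ :=
      (P i).walk.exists_mem_cutEdges (K := (X ⟨(P i).target, (P i).target_mem⟩)ᶜ)
        (hnotX ⟨_, (P i).target_mem⟩ _ (P i).source_mem (P i).source_ne_target)
        (fun h => h (hmemX ⟨_, (P i).target_mem⟩))
    obtain ⟨hb, c, hc, hbc⟩ := hb
    refine ⟨e, he, (mem_cutEdges_iff hbc _).2 (Or.inr ⟨?_, hb⟩)⟩
    by_contra hcX
    exact hc.2 hcX
  have hodd : ∀ K : {K : Set α | (G.deleteVerts (⋃ s, X s)).IsComponentSet K ∧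
      Odd (G.cutSize K)}, ∃ (s : T) (e : β), e ∈ G.cutEdges (X s) ∧
      (∀ i, e ∉ (P i).walk.edges) ∧ ∃ a ∈ K.1, ∃ b ∈ X s, G.IsLink e a b := by
    rintro ⟨K, hK, hodd⟩
    have hKX : ∀ a ∈ K, a ∉ ⋃ s, X s := fun a ha => by
      have := hK.subset_vertexSet ha
      rw [vertexSet_deleteVerts] at this
      exact this.2
    have hKT : ∀ t ∈ T, t ∉ K := fun t ht htK =>
      hKX t htK (Set.mem_iUnion.2 ⟨⟨t, ht⟩, hmemX ⟨t, ht⟩⟩)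
    -- If every edge of the cut were used, the cut would be partitioned by the paths. Each path has
    -- both ends outside `K` and so uses an even number of its edges.
    obtain ⟨e, he, hun⟩ : ∃ e ∈ G.cutEdges K, ∀ i, e ∉ (P i).walk.edges := by
      by_contra hcon
      push Not at hcon
      let L := (List.ofFn fun i => (P i).walk.edges)
      have hLn : L.flatten.Nodup := by
        rw [List.nodup_flatten]
        refine ⟨?_, ?_⟩
        · intro l hl
          obtain ⟨i, rfl⟩ := List.mem_ofFn.1 hl
          exact (P i).isPath.nodup_edges
        · rw [List.pairwise_ofFn]
          exact fun i j hij => hP hij.ne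
      have heven : Even (L.flatten.countP fun e => decide (e ∈ G.cutEdges K)) := by
        refine Routing.even_countP_flatten fun l hl => ?_
        obtain ⟨i, rfl⟩ := List.mem_ofFn.1 hl
        rw [← Nat.not_odd_iff_even, Walk.odd_countP_cutEdges, not_not]
        exact iff_of_false (hKT _ (P i).source_mem) (hKT _ (P i).target_mem)
      have hset : G.cutEdges K =
          ((L.flatten.filter fun e => decide (e ∈ G.cutEdges K)).toFinset : Set β) := by
        ext e
        simp only [List.coe_toFinset, List.mem_filter, decide_eq_true_eq, Set.mem_ofPred_eq]
        refine ⟨fun he => ⟨?_, he⟩, fun h => h.2⟩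
        obtain ⟨i, hi⟩ := hcon e he
        exact List.mem_flatten.2 ⟨_, List.mem_ofFn.2 ⟨i, rfl⟩, hi⟩
      rw [cutSize, hset, Set.ncard_coe_finset, List.toFinset_card_of_nodup (hLn.filter _),
        ← List.countP_eq_length_filter] at hodd
      exact (Nat.not_odd_iff_even.2 heven) hodd
    obtain ⟨a, ha, b, ⟨hbV, hbK⟩, hab⟩ := he
    have hb : b ∈ ⋃ s, X s := by
      by_contra hb
      exact hbK (hK.mem_of_isLink ha (e := e) ((deleteVerts_isLink _ _).2 ⟨hab, hKX a ha, hb⟩))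
    obtain ⟨s, hs⟩ := Set.mem_iUnion.1 hb
    have has : a ∉ X s := fun h => hKX a ha (Set.mem_iUnion.2 ⟨s, h⟩)
    exact ⟨s, e, (mem_cutEdges_iff hab _).2 (Or.inr ⟨hs, has⟩), hun, a, ha, b, hs, hab⟩
  choose e₁ he₁ he₁X using hsrc
  choose e₂ he₂ he₂X using htgt
  choose s₃ e₃ he₃X he₃ a₃ ha₃ b₃ hb₃ hab₃ using hodd
  have hfin : ∀ K, (G.cutEdges K).Finite := fun K => hE.subset (cutEdges_subset K)
  have : ∀ s : T, Finite (G.cutEdges (X s)) := fun s => hfin _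
  -- The target is a disjoint union because an edge between two of the sets counts for both: a path
  -- consisting of one such edge is charged to it twice.
  let f : (Fin k ⊕ Fin k) ⊕ {K : Set α | (G.deleteVerts (⋃ s, X s)).IsComponentSet K ∧
      Odd (G.cutSize K)} → Σ s : T, G.cutEdges (X s) :=
    Sum.elim (Sum.elim (fun i => ⟨⟨_, (P i).source_mem⟩, e₁ i, he₁X i⟩)
      (fun i => ⟨⟨_, (P i).target_mem⟩, e₂ i, he₂X i⟩)) (fun K => ⟨s₃ K, e₃ K, he₃X K⟩)
  let ed : (Σ s : T, G.cutEdges (X s)) → β := fun z => z.2.1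
  have hdis : ∀ i j e, e ∈ (P i).walk.edges → e ∈ (P j).walk.edges → i = j := by
    intro i j e hi hj
    by_contra hij
    exact hP hij hi hj
  have hf : Function.Injective f := by
    rintro ((i | i) | K) ((j | j) | L) h
    · have h2 : e₁ i = e₁ j := congrArg ed h
      rw [hdis i j _ (he₁ i) (h2 ▸ he₁ j)]
    · have h2 : e₁ i = e₂ j := congrArg ed h
      obtain rfl := hdis i j _ (he₁ i) (h2 ▸ he₂ j)
      have h1 := congrArg (fun z => (z.1 : α)) h
      exact absurd h1 (P i).source_ne_target
    · have h2 : e₁ i = e₃ L := congrArg ed h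
      exact absurd (h2 ▸ he₁ i) (he₃ L i)
    · have h2 : e₂ i = e₁ j := congrArg ed h
      obtain rfl := hdis i j _ (he₂ i) (h2 ▸ he₁ j)
      have h1 := congrArg (fun z => (z.1 : α)) h
      exact absurd h1 (P i).source_ne_target.symm
    · have h2 : e₂ i = e₂ j := congrArg ed h
      rw [hdis i j _ (he₂ i) (h2 ▸ he₂ j)]
    · have h2 : e₂ i = e₃ L := congrArg ed h
      exact absurd (h2 ▸ he₂ i) (he₃ L i)
    · have h2 : e₃ K = e₁ j := congrArg ed h
      exact absurd (h2 ▸ he₁ j) (he₃ K j)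
    · have h2 : e₃ K = e₂ j := congrArg ed h
      exact absurd (h2 ▸ he₂ j) (he₃ K j)
    · have h2 : e₃ K = e₃ L := congrArg ed h
      have hl := hab₃ L
      rw [← h2] at hl
      -- One end of the charged edge lies in the deleted sets and the other does not, so the edge
      -- determines its end in the component, and hence the component.
      have ha : a₃ K = a₃ L := by
        rcases (hab₃ K).left_eq_or_eq hl with h | h
        · exact h
        · exfalso
          have := K.2.1.subset_vertexSet (ha₃ K)
          rw [vertexSet_deleteVerts] at this
          exact this.2 (Set.mem_iUnion.2 ⟨_, h ▸ hb₃ L⟩)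
      have hKL : K.1 = L.1 := by
        rw [K.2.1.eq_of_mem (ha₃ K), L.2.1.eq_of_mem (ha₃ L), ha]
      rw [Subtype.ext hKL]
  have hO : Finite {K : Set α | (G.deleteVerts (⋃ s, X s)).IsComponentSet K ∧
      Odd (G.cutSize K)} := Finite.of_injective _ (hf.comp Sum.inr_injective)
  have hcard := Nat.card_le_card_of_injective f hf
  rw [Nat.card_sum, Nat.card_sum, Nat.card_sigma, Nat.card_fin, Nat.card_coe_set_eq] at hcard
  simp only [Nat.card_coe_set_eq] at hcard
  simp only [oddComponents, cutSize] at hcard ⊢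
  omega

/-! ### From chains of edges to `T`-paths -/

theorem Walk.edges_append {x y z : α} (w : G.Walk x y) (w' : G.Walk y z) :
    (w.append w').edges = w.edges ++ w'.edges := by
  induction w with
  | nil => rfl
  | cons e h w ih => simp [Walk.append, Walk.edges, ih]

theorem Walk.exists_of_mem_support {x y z : α} (w : G.Walk x y) (hz : z ∈ w.support) :
    ∃ (w₁ : G.Walk x z) (w₂ : G.Walk z y), w₁.support <+: w.support ∧ w₂.support <:+ w.support ∧
      w.edges = w₁.edges ++ w₂.edges := by
  induction w with
  | nil x hx =>
    obtain rfl : z = x := by simpa [Walk.support] using hz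
    exact ⟨.nil z hx, .nil z hx, List.prefix_rfl, List.suffix_rfl, by simp [Walk.edges]⟩
  | @cons x u y e h w ih =>
    by_cases hzx : z = x
    · subst hzx
      exact ⟨.nil z h.left_mem, .cons e h w, by simp [Walk.support], List.suffix_rfl,
        by simp [Walk.edges]⟩
    · obtain ⟨w₁, w₂, h1, h2, h3⟩ := ih (by simpa [Walk.support, hzx] using hz)
      exact ⟨.cons e h w₁, w₂, (List.cons_prefix_cons.2 ⟨rfl, h1⟩),
        h2.trans (List.suffix_cons _ _), by simp [Walk.edges, h3]⟩

theorem Walk.exists_isPath {x y : α} (w : G.Walk x y) :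
    ∃ p : G.Walk x y, p.IsPath ∧ p.edges ⊆ w.edges := by
  induction w with
  | nil x hx => exact ⟨.nil x hx, by simp [Walk.IsPath, Walk.support], fun _ h => h⟩
  | @cons x u y e h w ih =>
    obtain ⟨p, hp, hpw⟩ := ih
    by_cases hx : x ∈ p.support
    · obtain ⟨p₁, p₂, h1, h2, h3⟩ := p.exists_of_mem_support hx
      refine ⟨p₂, hp.sublist h2.sublist, fun f hf => List.mem_cons_of_mem _ (hpw ?_)⟩
      rw [h3]; exact List.mem_append_right _ hf
    · refine ⟨.cons e h p, ?_, ?_⟩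
      · simp only [Walk.IsPath, Walk.support, List.nodup_cons]
        exact ⟨hx, hp⟩
      · simp only [Walk.edges]
        exact List.cons_subset_cons _ hpw

/-- A path with an internal vertex in `T` can be stopped at that vertex; this shortens it and keeps
distinct ends in `T`. -/
theorem Walk.exists_tPath {T : Finset α} {x y : α} (w : G.Walk x y) (hx : x ∈ T) (hy : y ∈ T)
    (hxy : x ≠ y) : ∃ P : G.TPath T, P.walk.edges ⊆ w.edges := by
  have main : ∀ n, ∀ y (p : G.Walk x y), p.edges.length = n → p.IsPath → y ∈ T → x ≠ y →
      ∃ P : G.TPath T, P.walk.edges ⊆ p.edges := by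
    intro n
    induction n using Nat.strong_induction_on with
    | _ n ih =>
    intro y p hn hp hy hxy
    by_cases hint : ∀ z ∈ p.support, z ≠ x → z ≠ y → z ∉ T
    · exact ⟨⟨x, y, p, hp, hx, hy, hxy, hint⟩, fun _ h => h⟩
    · push Not at hint
      obtain ⟨z, hz, hzx, hzy, hzT⟩ := hint
      obtain ⟨p₁, p₂, h1, -, h3⟩ := p.exists_of_mem_support hz
      have hpos : 0 < p₂.edges.length := by
        cases p₂ with
        | nil => exact absurd rfl hzy
        | cons => simp [Walk.edges]
      have hlen := congrArg List.length h3
      rw [List.length_append] at hlen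
      obtain ⟨P, hP⟩ := ih p₁.edges.length (by omega) z p₁ rfl (hp.sublist h1.sublist) hzT hzx.symm
      refine ⟨P, fun e he => ?_⟩
      rw [h3]
      exact List.mem_append_left _ (hP he)
  obtain ⟨p, hp, hpw⟩ := w.exists_isPath
  obtain ⟨P, hP⟩ := main _ y p rfl hp hy hxy
  exact ⟨P, fun e he => hpw (hP he)⟩

theorem hasEdgeDisjointTPaths_of_lists {T : Finset α} {L : List (List β)} (hL : L.flatten.Nodup)
    (h : ∀ l ∈ L, ∃ P : G.TPath T, P.walk.edges ⊆ l) : G.HasEdgeDisjointTPaths T L.length := by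
  choose f hf using fun i : Fin L.length => h (L.get i) (L.get_mem i)
  refine ⟨f, fun i j hij => ?_⟩
  have hp := List.pairwise_iff_get.1 (List.nodup_flatten.1 hL).2
  intro e hi hj
  rcases lt_or_gt_of_ne hij with h | h
  · exact hp i j h (hf i hi) (hf j hj)
  · exact hp j i h (hf j hj) (hf i hi)

theorem exists_ends (G : Graph α β) : ∃ t : G.edgeSet → Bool → α,
    ∀ (e : G.edgeSet) (i : Bool), G.IsLink e.1 (t e i) (t e (!i)) := by
  choose a b h using fun e : G.edgeSet => G.exists_isLink_of_mem_edgeSet e.2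
  refine ⟨fun e i => if i then b e else a e, fun e i => ?_⟩
  cases i
  · simpa using h e
  · simpa using (h e).symm

open Classical in
/-- The vertices outside `T` are inner, those in `T` are classes. The natural numbers provide
further classes. -/
noncomputable def label (T : Finset α) (v : α) : α ⊕ (α ⊕ ℕ) :=
  if v ∈ T then .inr (.inl v) else .inl v

theorem label_eq_inl {T : Finset α} {v w : α} : label T v = .inl w ↔ v = w ∧ v ∉ T := by
  unfold label
  split_ifs with h <;> simp [h]

theorem label_eq_inr {T : Finset α} {v : α} {c : α ⊕ ℕ} :
    label T v = .inr c ↔ c = .inl v ∧ v ∈ T := by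
  unfold label
  split_ifs with h <;> simp [h, eq_comm]

/-- Several consecutive edges of a chain may share one vertex. The walk skips an edge that it would
enter and leave at the same end, so its edges are only among those of the chain. -/
theorem exists_walk_of_isChain {T : Finset α} {t : G.edgeSet → Bool → α}
    (ht : ∀ (e : G.edgeSet) (i : Bool), G.IsLink e.1 (t e i) (t e (!i))) {l : List G.edgeSet} {e f : G.edgeSet}
    (hl : l.IsChain (Routing.EdgeAdj fun e i => label T (t e i))) (he : l.head? = some e)
    (hf : l.getLast? = some f) (i j : Bool) :
    ∃ w : G.Walk (t e i) (t f j), w.edges ⊆ l.map Subtype.val := by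
  have one : ∀ (e : G.edgeSet) (i j : Bool), ∃ w : G.Walk (t e i) (t e j), w.edges ⊆ [e.1] := by
    intro e i j
    by_cases hij : j = i
    · subst hij
      exact ⟨.nil _ (ht e j).left_mem, by simp [Walk.edges]⟩
    · rw [Bool.eq_not_of_ne hij]
      exact ⟨.cons e.1 (ht e i) (.nil _ (ht e i).right_mem), by simp [Walk.edges]⟩
  induction l generalizing e i with
  | nil => simp at he
  | cons a l ih =>
    obtain rfl : a = e := by simpa using he
    cases l with
    | nil =>
      obtain rfl : a = f := by simpa using hf
      simpa using one a i j
    | cons b l =>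
      rw [List.isChain_cons_cons] at hl
      obtain ⟨⟨v, i₁, i₂, h1, h2⟩, hl⟩ := hl
      have h1 := (label_eq_inl.1 h1).1
      have h2 := (label_eq_inl.1 h2).1
      obtain ⟨w, hw⟩ := ih hl (e := b) rfl (by simpa [List.getLast?_cons] using hf) i₂
      obtain ⟨w', hw'⟩ : ∃ w : G.Walk (t a i) (t b i₂), w.edges ⊆ [a.1] := by
        rw [h2, ← h1]
        exact one a i i₁
      refine ⟨w'.append w, ?_⟩
      rw [Walk.edges_append, List.map_cons]
      exact List.append_subset.2 ⟨fun e he => List.mem_cons.2 (Or.inl (by simpa using hw' he)),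
        fun e he => List.mem_cons_of_mem _ (hw he)⟩

theorem exists_tPath_of_reg {T : Finset α} {t : G.edgeSet → Bool → α}
    (ht : ∀ (e : G.edgeSet) (i : Bool), G.IsLink e.1 (t e i) (t e (!i))) {l : List G.edgeSet}
    (hl : Routing.Reg (Routing.EdgeAdj fun e i => label T (t e i))
      (Routing.slotClass fun e i => label T (t e i)) l) :
    ∃ P : G.TPath T, P.walk.edges ⊆ l.map Subtype.val := by
  obtain ⟨h1, a, b, c, c', ha, hb, hc, hc', hne, -⟩ := hl
  obtain ⟨i, -, hi, -⟩ := Routing.slotClass_eq_some.1 hc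
  obtain ⟨j, -, hj, -⟩ := Routing.slotClass_eq_some.1 hc'
  obtain ⟨hi, hiT⟩ := label_eq_inr.1 hi
  obtain ⟨hj, hjT⟩ := label_eq_inr.1 hj
  obtain ⟨w, hw⟩ := exists_walk_of_isChain ht h1 ha hb i j
  obtain ⟨P, hP⟩ := w.exists_tPath hiT hjT (fun h => hne (by rw [hi, hj, h]))
  exact ⟨P, fun e he => hw (hP he)⟩

/-- The edges joining two distinct vertices of `T`. -/
def directEdges (T : Finset α) (t : G.edgeSet → Bool → α) : Set G.edgeSet :=
  {e | (∀ i, t e i ∈ T) ∧ t e false ≠ t e true}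

theorem hasEdgeDisjointTPaths_of_reg [Finite G.edgeSet] {T : Finset α} {t : G.edgeSet → Bool → α}
    (ht : ∀ (e : G.edgeSet) (i : Bool), G.IsLink e.1 (t e i) (t e (!i)))
    {L : List (List G.edgeSet)}
    (hL : ∀ l ∈ L, Routing.Reg (Routing.EdgeAdj fun e i => label T (t e i))
      (Routing.slotClass fun e i => label T (t e i)) l) (hLn : L.flatten.Nodup) :
    G.HasEdgeDisjointTPaths T (L.length + (directEdges T t).ncard) := by
  have hDf : (directEdges T t).Finite := Set.toFinite _
  let M : List (List G.edgeSet) := L ++ hDf.toFinset.toList.map fun e => [e]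
  have hM : M.flatten.Nodup := by
    have hflat : (hDf.toFinset.toList.map fun e => [e]).flatten = hDf.toFinset.toList := by
      rw [← List.flatMap_def]
      exact List.flatMap_singleton' _
    rw [List.flatten_append, hflat, List.nodup_append']
    refine ⟨hLn, Finset.nodup_toList _, fun e he he' => ?_⟩
    obtain ⟨l, hl, hel⟩ := List.mem_flatten.1 he
    obtain ⟨i, v, hi⟩ := (hL l hl).exists_inner hel
    have hD : e ∈ directEdges T t := by simpa using he'
    exact (label_eq_inl.1 hi).2 (hD.1 i)
  have hlen : (M.map (List.map Subtype.val)).length = L.length + (directEdges T t).ncard := by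
    simp [M, Set.ncard_eq_toFinset_card _ hDf]
  rw [← hlen]
  refine hasEdgeDisjointTPaths_of_lists ?_ ?_
  · rw [← List.map_flatten]
    exact hM.map Subtype.val_injective
  · intro l hl
    obtain ⟨m, hm, rfl⟩ := List.mem_map.1 hl
    rcases List.mem_append.1 hm with hm | hm
    · exact exists_tPath_of_reg ht (hL m hm)
    · obtain ⟨e, he, rfl⟩ := List.mem_map.1 hm
      have hD : e ∈ directEdges T t := by simpa using he
      obtain ⟨P, hP⟩ := Walk.exists_tPath (.cons e.1 (ht e false) (.nil _ (ht e false).right_mem))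
        (hD.1 false) (hD.1 _) hD.2
      exact ⟨P, by simpa [Walk.edges] using hP⟩

/-! ### From assignments to `T`-subpartitions -/

/-- The vertices of `G` in a given part. -/
def part (G : Graph α β) (T : Finset α) (φ : α → (α ⊕ ℕ) ⊕ α) (p : (α ⊕ ℕ) ⊕ α) : Set α :=
  {v ∈ G.vertexSet | Routing.ext φ (label T v) = p}

theorem cutSize_part {T : Finset α} {t : G.edgeSet → Bool → α}
    (ht : ∀ (e : G.edgeSet) (i : Bool), G.IsLink e.1 (t e i) (t e (!i)))
    (φ : α → (α ⊕ ℕ) ⊕ α) (p : (α ⊕ ℕ) ⊕ α) :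
    G.cutSize (G.part T φ p) = Routing.boundary (fun e i => label T (t e i)) φ p := by
  have hmem : ∀ (e : G.edgeSet) i, t e i ∈ G.part T φ p ↔ Routing.ext φ (label T (t e i)) = p :=
    fun e i => ⟨fun h => h.2, fun h => ⟨(ht e i).left_mem, h⟩⟩
  symm
  refine Set.ncard_congr (fun d _ => d.1.1) ?_ ?_ ?_
  · rintro ⟨e, i⟩ ⟨h1, h2⟩
    exact (mem_cutEdges_iff (ht e i) _).2 (Or.inl ⟨(hmem e i).2 h1, fun h => h2 ((hmem e _).1 h)⟩)
  · rintro ⟨e, i⟩ ⟨e', j⟩ ⟨h1, h2⟩ ⟨h3, h4⟩ heq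
    obtain rfl : e = e' := Subtype.ext heq
    have : i = j := by
      by_contra hne
      rw [Bool.eq_not_of_ne hne, Bool.not_not] at h2
      exact h2 h3
    rw [this]
  · intro e he
    let e' : G.edgeSet := ⟨e, cutEdges_subset _ he⟩
    rcases (mem_cutEdges_iff (ht e' false) _).1 he with h | h
    · exact ⟨(e', false), ⟨(hmem e' _).1 h.1, fun h' => h.2 ((hmem e' _).2 h')⟩, rfl⟩
    · exact ⟨(e', true), ⟨(hmem e' _).1 h.1, fun h' => h.2 ((hmem e' _).2 h')⟩, rfl⟩

theorem isTSubpartition_part {T : Finset α} (hT : (T : Set α) ⊆ G.vertexSet)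
    (φ : α → (α ⊕ ℕ) ⊕ α) :
    G.IsTSubpartition T fun s => G.part T φ (.inl (.inl s)) := by
  refine ⟨fun s v hv => hv.1, fun s s' hne => ?_, fun s => ?_⟩
  · refine Set.disjoint_left.2 fun v h1 h2 => ?_
    have := h1.2.symm.trans h2.2
    simp only [Sum.inl.injEq] at this
    exact hne (Subtype.ext this)
  · have key : ∀ v ∈ T, Routing.ext φ (label T v) = .inl (.inl v) := by
      intro v hv
      rw [label_eq_inr.2 ⟨rfl, hv⟩]
      rfl
    ext v
    constructor
    · rintro ⟨h1, h2⟩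
      have := (key v h2).symm.trans h1.2
      simpa using this
    · rintro rfl
      exact ⟨⟨hT s.2, key s s.2⟩, s.2⟩

/-- A boundary end on an edge with an inner end is counted by `weight`. The remaining ones lie on
edges joining distinct vertices of `T`, with at most two ends each. -/
theorem sum_cutSize_part_le [Finite G.edgeSet] {T : Finset α} {t : G.edgeSet → Bool → α}
    (ht : ∀ (e : G.edgeSet) (i : Bool), G.IsLink e.1 (t e i) (t e (!i)))
    (φ : α → (α ⊕ ℕ) ⊕ α) :
    ∑ s : T, G.cutSize (G.part T φ (.inl (.inl s))) ≤
      Routing.weight (fun e i => label T (t e i)) φ + 2 * (directEdges T t).ncard := by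
  set g : G.edgeSet → Bool → α ⊕ (α ⊕ ℕ) := fun e i => label T (t e i) with hg
  let W : Set (G.edgeSet × Bool) := {d | (Routing.ext φ (g d.1 d.2)).isLeft ∧
    Routing.ext φ (g d.1 (!d.2)) ≠ Routing.ext φ (g d.1 d.2)}
  have h1 : ∑ s : T, G.cutSize (G.part T φ (.inl (.inl s))) ≤ W.ncard := by
    let B : T → Set (G.edgeSet × Bool) := fun s => {d | Routing.ext φ (g d.1 d.2) = .inl (.inl s) ∧
      Routing.ext φ (g d.1 (!d.2)) ≠ .inl (.inl s)}
    let f : (Σ s : T, B s) → W := fun z => ⟨z.2.1, by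
      rw [show Routing.ext φ (g z.2.1.1 z.2.1.2) = _ from z.2.2.1]; rfl, by
      rw [show Routing.ext φ (g z.2.1.1 z.2.1.2) = _ from z.2.2.1]; exact z.2.2.2⟩
    have hf : Function.Injective f := by
      rintro ⟨s, d, hd⟩ ⟨s', d', hd'⟩ h
      obtain rfl : d = d' := congrArg Subtype.val h
      have h2 := hd.1.symm.trans hd'.1
      simp only [Sum.inl.injEq] at h2
      obtain rfl : s = s' := Subtype.ext h2
      rfl
    have hcard := Nat.card_le_card_of_injective f hf
    rw [Nat.card_sigma] at hcard
    simp only [Nat.card_coe_set_eq] at hcard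
    refine le_trans (le_of_eq ?_) hcard
    exact Finset.sum_congr rfl fun s _ => cutSize_part ht φ _
  have h2 : (directEdges T t ×ˢ (Set.univ : Set Bool)).ncard = 2 * (directEdges T t).ncard := by
    rw [Set.ncard_prod, Set.ncard_univ, Nat.card_eq_fintype_card, Fintype.card_bool, mul_comm]
  rw [← h2]
  refine h1.trans ((Set.ncard_le_ncard ?_ (Set.toFinite _)).trans (Set.ncard_union_le _ _))
  rintro ⟨e, i⟩ ⟨h3, h4⟩
  by_cases hin : ∃ i v, g e i = .inl v
  · exact Or.inl ⟨hin, h3, h4⟩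
  · right
    refine ⟨⟨fun j => ?_, fun h => h4 ?_⟩, Set.mem_univ _⟩
    · by_contra hj
      exact hin ⟨j, _, label_eq_inl.2 ⟨rfl, hj⟩⟩
    · cases i <;> simp [hg, h]

/-- Every block with odd boundary is nonempty in `G` and is exactly a component of what remains
after deletion. Elements of `α` that label no edge end, such as the inner copies of vertices of `T`,
create no odd block. -/
theorem oddBlocks_le_oddComponents (hV : G.vertexSet.Finite) {T : Finset α}
    {t : G.edgeSet → Bool → α}
    (ht : ∀ (e : G.edgeSet) (i : Bool), G.IsLink e.1 (t e i) (t e (!i)))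
    {φ : α → (α ⊕ ℕ) ⊕ α} (hφ : Routing.Valid (fun e i => label T (t e i)) φ) :
    Routing.oddBlocks (fun e i => label T (t e i)) φ ≤
      G.oddComponents T fun s => G.part T φ (.inl (.inl s)) := by
  set g : G.edgeSet → Bool → α ⊕ (α ⊕ ℕ) := fun e i => label T (t e i) with hg
  set H := G.deleteVerts (⋃ s : T, G.part T φ (.inl (.inl s))) with hH
  have hpart : ∀ v b, Routing.ext φ (label T v) = .inr b → φ v = .inr b ∧ v ∉ T := by
    intro v b h
    unfold label at h
    split_ifs at h with hv
    · simp [Routing.ext] at h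
    · exact ⟨h, hv⟩
  have hnotX : ∀ v b, φ v = .inr b → v ∉ T → v ∉ ⋃ s : T, G.part T φ (.inl (.inl s)) := by
    intro v b h hv hX
    obtain ⟨s, hs⟩ := Set.mem_iUnion.1 hX
    have := hs.2
    rw [label_eq_inl.2 ⟨rfl, hv⟩] at this
    simp [Routing.ext, h] at this
  -- By `present`, only classes that occur are assigned, and these are vertices of `T`. So no vertex
  -- sits in one of the auxiliary classes, and whatever is not deleted belongs to a block.
  have hHv : ∀ v ∈ H.vertexSet, ∃ b, φ v = .inr b ∧ v ∉ T := by
    intro v hv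
    rw [hH, vertexSet_deleteVerts] at hv
    have hX : ∀ s ∈ T, Routing.ext φ (label T v) ≠ .inl (.inl s) := fun s hs h =>
      hv.2 (Set.mem_iUnion.2 ⟨⟨s, hs⟩, hv.1, h⟩)
    have hvT : v ∉ T := fun h => hX v h (by rw [label_eq_inr.2 ⟨rfl, h⟩]; rfl)
    rcases h : φ v with c | b
    · obtain ⟨e, i, hei⟩ := hφ.present v c h
      obtain ⟨rfl, hT⟩ := label_eq_inr.1 hei
      exact absurd (by rw [label_eq_inl.2 ⟨rfl, hvT⟩]; exact h) (hX _ hT)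
    · exact ⟨b, rfl, hvT⟩
  have hmemV : ∀ v b, φ v = .inr b → v ∉ T → v ∈ G.vertexSet → v ∈ H.vertexSet := by
    intro v b h hv hvG
    rw [hH, vertexSet_deleteVerts]
    exact ⟨hvG, hnotX v b h hv⟩
  have hto : ∀ x y, H.Walk x y → ∀ b, φ x = .inr b → φ y = .inr b := by
    intro x y w
    induction w with
    | nil => exact fun b h => h
    | @cons x z y e h w ih =>
      intro b hb
      refine ih b ?_
      obtain ⟨c, hc, hzT⟩ := hHv z h.right_mem
      obtain ⟨b', hb', hxT⟩ := hHv x h.left_mem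
      have hGl := ((deleteVerts_isLink _ _).1 h).1
      have hlink : Routing.Links g ⟨e, hGl.edge_mem⟩ x z := by
        let e' : G.edgeSet := ⟨e, hGl.edge_mem⟩
        rcases hGl.eq_and_eq_or_eq_and_eq (ht e' false) with ⟨h1, h2⟩ | ⟨h1, h2⟩
        · exact ⟨false, label_eq_inl.2 ⟨h1.symm, h1 ▸ hxT⟩, label_eq_inl.2 ⟨h2.symm, h2 ▸ hzT⟩⟩
        · exact ⟨true, label_eq_inl.2 ⟨h1.symm, h1 ▸ hxT⟩, label_eq_inl.2 ⟨h2.symm, h2 ▸ hzT⟩⟩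
      have := (hφ.connected x z b c hb hc).2
        (.single ⟨⟨_, hlink⟩, by rw [hb]; rfl, by rw [hc]; rfl⟩)
      rw [hc, this]
  have hfrom : ∀ x y, x ∈ H.vertexSet → Relation.ReflTransGen (Routing.Step g φ) x y →
      Nonempty (H.Walk x y) := by
    intro x y hx h
    induction h with
    | refl => exact ⟨.nil x hx⟩
    | @tail y z _ h ih =>
      obtain ⟨w⟩ := ih
      obtain ⟨⟨e, i, h1, h2⟩, hy, hz⟩ := h
      obtain ⟨h1, hyT⟩ := label_eq_inl.1 h1
      obtain ⟨h2, hzT⟩ := label_eq_inl.1 h2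
      obtain ⟨b, hb⟩ := Sum.isRight_iff.1 hy
      obtain ⟨c, hc⟩ := Sum.isRight_iff.1 hz
      have hl : H.IsLink e.1 y z := by
        rw [hH, deleteVerts_isLink, ← h1, ← h2]
        exact ⟨ht e i, hnotX _ b (h1 ▸ hb) hyT, hnotX _ c (h2 ▸ hc) hzT⟩
      exact ⟨w.append (.cons e.1 hl (.nil _ hl.right_mem))⟩
  have hodd : ∀ b, Odd (Routing.boundary g φ (.inr b)) →
      ∃ x ∈ G.part T φ (.inr b), x ∈ H.vertexSet := by
    intro b hb
    obtain ⟨d, hd⟩ := Set.nonempty_of_ncard_ne_zero (s := {d : G.edgeSet × Bool |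
      Routing.ext φ (g d.1 d.2) = .inr b ∧ Routing.ext φ (g d.1 (!d.2)) ≠ .inr b}) (by
        intro h0
        have : Routing.boundary g φ (.inr b) = 0 := h0
        simp [this] at hb)
    obtain ⟨h1, h2⟩ := hpart _ _ hd.1
    exact ⟨t d.1 d.2, ⟨(ht d.1 d.2).left_mem, hd.1⟩, hmemV _ b h1 h2 (ht d.1 d.2).left_mem⟩
  refine Set.ncard_le_ncard_of_injOn (fun b => G.part T φ (.inr b)) ?_ ?_ ?_
  · intro b hb
    obtain ⟨x, hx, hxH⟩ := hodd b hb
    obtain ⟨hxb, hxT⟩ := hpart _ _ hx.2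
    refine ⟨⟨x, hxH, ?_⟩, ?_⟩
    · ext y
      constructor
      · intro hy
        obtain ⟨hyb, hyT⟩ := hpart _ _ hy.2
        exact hfrom x y hxH ((hφ.connected x y b b hxb hyb).1 rfl)
      · rintro ⟨w⟩
        have hyb := hto x y w b hxb
        obtain ⟨-, -, hyT⟩ := hHv y w.right_mem
        have hyV := w.right_mem
        rw [vertexSet_deleteVerts] at hyV
        refine ⟨hyV.1, ?_⟩
        rw [label_eq_inl.2 ⟨rfl, hyT⟩]
        exact hyb
    · rw [cutSize_part ht]
      exact hb
  · intro b hb b' hb' h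
    obtain ⟨x, hx, -⟩ := hodd b hb
    have hx' : x ∈ G.part T φ (.inr b') := by
      have h : G.part T φ (.inr b) = G.part T φ (.inr b') := h
      rw [← h]; exact hx
    exact Sum.inr.inj (hx.2.symm.trans hx'.2)
  · refine hV.finite_subsets.subset fun K hK => ?_
    have := hK.1.subset_vertexSet
    rw [vertexSet_deleteVerts] at this
    exact this.trans Set.sdiff_subset

end

end Graph

theorem theorem1 {α β : Type*} (G : Graph α β)
    (hV : G.vertexSet.Finite) (hE : G.edgeSet.Finite)
    (T : Finset α) (hT : (T : Set α) ⊆ G.vertexSet) :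
    ∃ m : ℕ,
      IsGreatest {k : ℕ | G.HasEdgeDisjointTPaths T k} m ∧
      IsLeast {q : ℚ | ∃ X : T → Set α, G.IsTSubpartition T X ∧ q = G.kappa T X} (m : ℚ) := by
  obtain ⟨t, ht⟩ := G.exists_ends
  have hEf : Finite G.edgeSet := hE
  obtain ⟨L, φ, hL, hLn, hφ, hw⟩ := Routing.hasMinMax fun e i => Graph.label T (t e i)
  have hk := Graph.hasEdgeDisjointTPaths_of_reg ht hL hLn
  have hX := Graph.isTSubpartition_part hT φ
  set k := L.length + (Graph.directEdges T t).ncard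
  have h1 := Graph.sum_cutSize_part_le (T := T) ht φ
  have h2 := Graph.oddBlocks_le_oddComponents hV ht hφ
  set X : T → Set α := fun s => G.part T φ (.inl (.inl s))
  change ∑ s : T, G.cutSize (X s) ≤ _ at h1
  have hle : ∀ {k' : ℕ} {Y : T → Set α}, G.HasEdgeDisjointTPaths T k' → G.IsTSubpartition T Y →
      2 * k' + G.oddComponents T Y ≤ ∑ s : T, G.cutSize (Y s) :=
    fun h hY => h.two_mul_add_le hE hY
  refine ⟨k, ⟨hk, fun k' hk' => ?_⟩, ⟨X, hX, ?_⟩, ?_⟩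
  · have h3 := hle hk' hX
    omega
  -- The easy inequality for `X` and the chain of bounds `h1`, `hw`, `h2` enclose the sum from both
  -- sides.
  · have h3 : ∑ s : T, G.cutSize (X s) = 2 * k + G.oddComponents T X := by
      have := hle hk hX
      omega
    rw [Graph.kappa, ← Nat.cast_sum, h3]
    push_cast
    ring
  · rintro q ⟨Y, hY, rfl⟩
    have h3 : ((2 * k + G.oddComponents T Y : ℕ) : ℚ) ≤ (∑ s : T, G.cutSize (Y s) : ℕ) :=
      Nat.cast_le.2 (hle hk hY)
    rw [Graph.kappa, ← Nat.cast_sum]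
    push_cast at h3 ⊢
    linarith
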